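/- Setting. Let $\Gamma\subset\mathbb R^2$ be the range of a $C^2$ arc length parameterization $\gamma:[0,L]\to\mathbb R^2$, $0<L<\infty$, without self-intersections, except that $\Gamma$ may be closed, i.e. $\gamma(0)=\gamma(L)$; in that case also $\gamma'(0)=\gamma'(L)$ and $\gamma''(0)=\gamma''(L)$. Let $\sigma_\Gamma$ be the arc length measure on $\Gamma$, let $\alpha>0$, and let $H$ be the self-adjoint operator in $L^2(\mathbb R^2)$ associated with the form $$\mathcal E(\psi,\varphi)=\int_{\mathbb R^2}\nabla\psi\cdot\nabla\overline\varphi\,dx-\alpha\int (I\psi)\,\overline{I\varphi}\,d\sigma_\Gamma ,\qquad \psi,\varphi\in W^{1,2}(\mathbb R^2),$$ where $I:W^{1,2}(\mathbb R^2)\to L^2(\sigma_\Gamma)$ is the trace map. Constants of the curve. Let $K=\max_{[0,L]}|\gamma''|$. For a map $c:[0,L]\to\mathbb R^2$ and $m>0$ let $M_c(m)$ be the largest number with $M_c(m)|s-s'|\le|c(s)-c(s')|$ for all $s,s'\in[0,L]$ with $|s-s'|\le m$. If $\Gamma$ is closed, put $M=\min\{M_\gamma(L/2),M_{\tilde\gamma}(L/2)\}$,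 where $\tilde\gamma(s)=\gamma(s+L/2)$ for $0\le s<L/2$ and $\tilde\gamma(s)=\gamma(s-L/2)$ for $L/2\le s\le L$; if $\Gamma$ is not closed, put $M=M_\gamma(L)$. Let $R$ be the infimum of the radii of the balls containing the convex hull of $\{x:\operatorname{dist}(x,\Gamma)\le1\}$. Admissible points. Let $S$ be a line segment of length $2b$ whose mid point lies on $\Gamma$. A point $y\in\mathbb R^2\setminus\Gamma$ is $S$-admissible, with unit vector $e$ parallel to $S$, if the ray $\{y-te: t\ge0\}$ meets $\Gamma$ and, with $d_S(y)=\min\{t\ge0: y-te\in\Gamma\}$, $\gamma(s_y)=y-d_S(y)e$ and $\cos\theta=\langle e,\gamma'(s_y)\rangle$, one has $|\cos\theta|<1$ and $d_S(y)\le b$. (The last condition holds for each $y\in S\setminus\Gamma$ when $e$ is oriented so that the ray passes through the mid point of $S$.) Put $$\delta_0=\min\Big\{\frac L2,\ \frac{M_\gamma(L/2)}{2K}\cdot\frac{1-|\cos\theta|}{2}\Big\},\qquad b_1=\frac{M\delta_0}{2},$$ with $\delta_0=L/2$ if $K=0$. Proposition. There are constants $c_3^\Gamma=c_3(M,K)$,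 depending only on $M$ and $K$, and $c_4^\Gamma=c_4(M)$, depending only on $M$, such that for all $\Gamma$, $\alpha>0$ and $\kappa>0$ as above the following holds. Every eigenfunction $\psi$ of $H$ with eigenvalue $-\kappa^2$ is essentially bounded and has a continuous representative, again denoted by $\psi$, which is differentiable on $\mathbb R^2\setminus\Gamma$; and for every line segment $S$ and every $S$-admissible point $y$ with vector $e$ as above, if $|\cos\theta|\le\sqrt3/2$ and $b\le\min\{1,b_1\}$, then $$|\nabla\psi(y)|\le\Big[\mathcal S_{\kappa,\Gamma}+\alpha c_4^\Gamma\,|\log d_S(y)|\Big]\,\|\psi\|_\infty ,$$ where $$\mathcal S_{\kappa,\Gamma}=2\kappa^2(R+1)+C_5(\kappa R)^{1/2}e^{\kappa R}+\alpha\big(c_3^\Gamma+c_4^\Gamma\log(\max\{1,L\})\big),\qquad C_5=2\int_0^\infty\sqrt x\,e^{-x}\,dx .$$ -/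

import Mathlib

open MeasureTheory Filter Topology Set
open scoped ENNReal ContDiff

noncomputable section

namespace LeakyCurve

/-- The Euclidean plane. -/
abbrev Plane : Type := EuclideanSpace ℝ (Fin 2)

/-- A finite `C²` curve in the plane, parameterized by arc length on `[0, L]`, without
self-intersections.  Only the values of `γ` on `[0, L]` matter.  The curve is open if
`γ 0 ≠ γ L`; if `γ 0 = γ L` it is a closed curve, and then the first two derivatives are
required to agree at the parameter values `0` and `L`. -/
structure Curve where
  L : ℝ
  L_pos : 0 < L
  γ : ℝ → Plane
  contDiffOn : ContDiffOn ℝ 2 γ (Icc 0 L)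
  unit_speed : ∀ s ∈ Icc 0 L, ‖derivWithin γ (Icc 0 L) s‖ = 1
  injOn_Ico : InjOn γ (Ico 0 L)
  injOn_Ioc : InjOn γ (Ioc 0 L)
  deriv_closed : γ 0 = γ L →
    derivWithin γ (Icc 0 L) 0 = derivWithin γ (Icc 0 L) L
  deriv2_closed : γ 0 = γ L →
    iteratedDerivWithin 2 γ (Icc 0 L) 0 = iteratedDerivWithin 2 γ (Icc 0 L) L

/-- For `c : ℝ → Plane` regarded on `[0, L]`: the largest constant `M` such that
`M * |s - s'| ≤ ‖c s - c s'‖` for all `s, s' ∈ [0, L]` with `|s - s'| ≤ m`. -/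
def chordConst (L : ℝ) (c : ℝ → Plane) (m : ℝ) : ℝ :=
  sSup {M : ℝ | ∀ s ∈ Icc 0 L, ∀ s' ∈ Icc 0 L, |s - s'| ≤ m → M * |s - s'| ≤ ‖c s - c s'‖}

namespace Curve

variable (Γ : Curve)

/-- The range of the parameterization. -/
def carrier : Set Plane := Γ.γ '' Icc 0 Γ.L

/-- The unit tangential vector at the parameter value `s`. -/
def tangent (s : ℝ) : Plane := derivWithin Γ.γ (Icc 0 Γ.L) s

/-- The arc length measure `σ_Γ`, as a measure on the plane. -/
def sigma : Measure Plane := Measure.map Γ.γ (volume.restrict (Icc 0 Γ.L))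

/-- The maximum of the curvature `|γ''|`. -/
def K : ℝ := sSup ((fun s => ‖iteratedDerivWithin 2 Γ.γ (Icc 0 Γ.L) s‖) '' Icc 0 Γ.L)

/-- The parameterization cut and glued at the opposite point (of interest for closed curves). -/
def shifted (s : ℝ) : Plane :=
  if s < Γ.L / 2 then Γ.γ (s + Γ.L / 2) else Γ.γ (s - Γ.L / 2)

open Classical in
/-- The injectivity constant `M` of the curve: `min {M_γ(L/2), M_γ̃(L/2)}` for a closed curve,
with `γ̃` the shifted parameterization, and `M_γ(L)` for a curve that is not closed. -/
def M : ℝ :=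
  if Γ.γ 0 = Γ.γ Γ.L then
    min (chordConst Γ.L Γ.γ (Γ.L / 2)) (chordConst Γ.L Γ.shifted (Γ.L / 2))
  else chordConst Γ.L Γ.γ Γ.L

/-- The infimum of the radii of the balls that contain the convex hull of the closed
`1`-neighbourhood of the curve. -/
def R : ℝ :=
  sInf {r : ℝ | 0 < r ∧ ∃ x : Plane,
    convexHull ℝ (Metric.cthickening 1 Γ.carrier) ⊆ Metric.closedBall x r}

open Classical in
/-- `δ₀ = min {L/2, (M_γ(L/2) / (2K)) * (1 - |cos θ|) / 2}`, where the second term is `∞`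
if the curve is straight. -/
def delta0 (cosθ : ℝ) : ℝ :=
  if Γ.K = 0 then Γ.L / 2
  else min (Γ.L / 2) (chordConst Γ.L Γ.γ (Γ.L / 2) / (2 * Γ.K) * ((1 - |cosθ|) / 2))

/-- `b₁ = M δ₀ / 2`. -/
def b1 (cosθ : ℝ) : ℝ := Γ.M * Γ.delta0 cosθ / 2

/-- The distance `d_S(y)` from `y` to the curve along the ray `{y - t e | t ≥ 0}`: the smallest
`t ≥ 0` with `y - t e ∈ Γ` (the curve is compact, so the infimum is attained as soon as the ray
meets the curve). -/
def rayDist (y e : Plane) : ℝ := sInf {t : ℝ | 0 ≤ t ∧ y - t • e ∈ Γ.carrier}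

/-- `y` is an admissible point for the segment `S` with end points `P` and `Q`, with unit vector
`e` parallel to `S`: the mid point of `S` lies on the curve, `y` does not, the ray
`{y - t e | t ≥ 0}` meets the curve, its first point on the curve is `γ s`, and there the ray is
not tangential to the curve. -/
structure IsAdmissible (P Q y e : Plane) (s : ℝ) : Prop where
  mid_mem : midpoint ℝ P Q ∈ Γ.carrier
  not_mem : y ∉ Γ.carrier
  norm_eq_one : ‖e‖ = 1
  parallel : ∃ c : ℝ, Q - P = c • e
  ray_meets : ∃ t : ℝ, 0 ≤ t ∧ y - t • e ∈ Γ.carrier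
  param_mem : s ∈ Icc 0 Γ.L
  first_hit : Γ.γ s = y - Γ.rayDist y e • e
  not_tangent : |inner ℝ e (Γ.tangent s)| < 1

end Curve

/-- The (classical) gradient of a complex valued function, a vector in `ℂ²`. -/
def grad (u : Plane → ℂ) (x : Plane) : EuclideanSpace ℂ (Fin 2) :=
  WithLp.toLp 2 fun i => fderiv ℝ u x (EuclideanSpace.single i 1)

/-- `G` is the weak gradient of `ψ`. -/
def IsWeakGradient (ψ : Plane → ℂ) (G : Plane → EuclideanSpace ℂ (Fin 2)) : Prop :=
  ∀ φ : Plane → ℂ, ContDiff ℝ ∞ φ → HasCompactSupport φ → ∀ i : Fin 2,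
    ∫ x, ψ x * grad φ x i = - ∫ x, G x i * φ x

/-- `τ ∈ L²(σ_Γ)` is the trace on the curve of the function `ψ` with weak gradient `G`: the trace
map is the continuous extension, from `W^{1,2}` to `L²(σ_Γ)`, of the restriction to the curve of
smooth compactly supported functions. -/
def IsTrace (Γ : Curve) (ψ : Plane → ℂ) (G : Plane → EuclideanSpace ℂ (Fin 2))
    (τ : Plane → ℂ) : Prop :=
  MemLp τ 2 Γ.sigma ∧
  ∃ φ : ℕ → Plane → ℂ, (∀ n, ContDiff ℝ ∞ (φ n) ∧ HasCompactSupport (φ n)) ∧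
    Tendsto (fun n => eLpNorm (φ n - ψ) 2 volume) atTop (𝓝 0) ∧
    Tendsto (fun n => eLpNorm (grad (φ n) - G) 2 volume) atTop (𝓝 0) ∧
    Tendsto (fun n => eLpNorm (φ n - τ) 2 Γ.sigma) atTop (𝓝 0)

/-- `ψ` is in `W^{1,2}`, with weak gradient `G` and with trace `τ` on the curve. -/
structure IsSobolev (Γ : Curve) (ψ : Plane → ℂ) (G : Plane → EuclideanSpace ℂ (Fin 2))
    (τ : Plane → ℂ) : Prop where
  memLp : MemLp ψ 2 volume
  memLp_grad : MemLp G 2 volume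
  weakGradient : IsWeakGradient ψ G
  trace : IsTrace Γ ψ G τ

/-- The value `∫ ∇ψ · conj ∇φ dx - α ∫ (Iψ) conj (Iφ) dσ_Γ` of the form, in terms of the weak
gradients `G` of `ψ` and `G'` of `φ`, and of the traces `τ` of `ψ` and `τ'` of `φ`. -/
def formValue (Γ : Curve) (α : ℝ) (G : Plane → EuclideanSpace ℂ (Fin 2)) (τ : Plane → ℂ)
    (G' : Plane → EuclideanSpace ℂ (Fin 2)) (τ' : Plane → ℂ) : ℂ :=
  (∫ x, ∑ i : Fin 2, G x i * (starRingEnd ℂ) (G' x i)) -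
    (α : ℂ) * ∫ x, τ x * (starRingEnd ℂ) (τ' x) ∂Γ.sigma

/-- `ψ` is in the domain of the self-adjoint operator `H` associated with the form above, and
`H ψ = f`: that is, `ψ ∈ W^{1,2}`, `f ∈ L²`, and the form at `(ψ, φ)` is `(f, φ)` for all
`φ ∈ W^{1,2}`. -/
def IsHamiltonianValue (Γ : Curve) (α : ℝ) (ψ f : Plane → ℂ) : Prop :=
  MemLp f 2 volume ∧
  ∃ (G : Plane → EuclideanSpace ℂ (Fin 2)) (τ : Plane → ℂ), IsSobolev Γ ψ G τ ∧
    ∀ (φ : Plane → ℂ) (G' : Plane → EuclideanSpace ℂ (Fin 2)) (τ' : Plane → ℂ),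
      IsSobolev Γ φ G' τ' →
        formValue Γ α G τ G' τ' = ∫ x, f x * (starRingEnd ℂ) (φ x)

/-- `ψ` is an eigenfunction of `H` with eigenvalue `E`. -/
def IsEigenfunction (Γ : Curve) (α E : ℝ) (ψ : Plane → ℂ) : Prop :=
  IsHamiltonianValue Γ α ψ (fun x => (E : ℂ) * ψ x) ∧ ¬ (ψ =ᵐ[volume] 0)

/-- The absolute constant `C₅ = 2 ∫₀^∞ √x e^{-x} dx`. -/
def C5 : ℝ := 2 * ∫ x in Ioi (0 : ℝ), Real.sqrt x * Real.exp (-x)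

/-- The quantity `𝒮_{κ,Γ}`, for given constants `c₃` and `c₄`. -/
def calS (Γ : Curve) (α κ c₃ c₄ : ℝ) : ℝ :=
  2 * κ ^ 2 * (Γ.R + 1) + C5 * Real.sqrt (κ * Γ.R) * Real.exp (κ * Γ.R) +
    α * (c₃ + c₄ * Real.log (max 1 Γ.L))

end LeakyCurve

end

noncomputable section

namespace LeakyCurve

/-! The eigenvalue equation says that `-Δψ + κ²ψ = α τ σ_Γ`, where `τ` is the trace of `ψ`. Hence
`ψ` should be the single layer potential of `τ`, with kernel the time integral of `e^{-κ²t}` times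
the heat kernel. No Bessel functions are needed. Testing the equation with the heat kernel centred
at `x`, whose Laplacian is its time derivative, gives `d/dt (e^{-κ²t} heat_t ∗ ψ) = -α e^{-κ²t}
heat_t ∗ (τ σ_Γ)`. Integrating over `(ε, ∞)` and letting `ε → 0` identifies `ψ` almost everywhere
with `layerPotential` (`exp_mul_heatConv_eq`, `ae_eq_layerPotential`). A Gaussian integral along the
curve is `O(√t)`, so an `L²` density contributes at most `O(t^{-3/4})`. This is integrable at `0`
uniformly in `x`, and makes the potential bounded and continuous.

The trace is bounded by the sup norm of the potential (`norm_trace_le`): the equation turns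
integrals against `τ` into volume integrals, so the approximation that defines the trace and the
mollifications of `ψ` have the same limits.

Off the curve the potential may be differentiated under the integral. Since `∫₀^∞ |∇heat_t(z)| dt =
1/(2π|z|)` (`integral_heat_gradient`), the gradient at `y` is at most `α ‖ψ‖_∞ / (2π)` times `∫ |y -
z|⁻¹ dσ_Γ(z)` (`norm_grad_layerPotential_le`).

It remains to see that this integral grows only logarithmically in `1/d`, where `d = d_S(y)`. If
`s₀` is the parameter of the point where the ray hits the curve, then `|y - γ(s)|` is at least
`M/20` times `d` plus the arc length distance from `s` to `s₀` (`IsAdmissible.exists_norm_sub_ge`).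
Near `s₀` this is transversality, with the curvature as a perturbation that `δ₀` keeps small; far
from `s₀` it is the chord-arc constant, since `d ≤ M δ₀ / 2`. The resulting bound has the form `α
(c₃ + c₄ log max(1, L) + c₄ |log d|) ‖ψ‖_∞`; the other terms of `calS` are nonnegative and are
simply added. -/

lemma grad_apply (u : Plane → ℂ) (x : Plane) (i : Fin 2) :
    grad u x i = fderiv ℝ u x (EuclideanSpace.single i 1) := rfl

lemma continuous_grad_apply {u : Plane → ℂ} (hu : ContDiff ℝ ∞ u) (i : Fin 2) :
    Continuous fun x => grad u x i := by
  simp only [grad_apply]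
  exact (hu.continuous_fderiv (by simp)).clm_apply continuous_const

lemma grad_mul_apply {u v : Plane → ℂ} {x : Plane} (hu : DifferentiableAt ℝ u x)
    (hv : DifferentiableAt ℝ v x) (i : Fin 2) :
    grad (fun x => u x * v x) x i = u x * grad v x i + v x * grad u x i := by
  simp only [grad_apply]
  rw [fderiv_fun_mul hu hv]
  simp

lemma grad_conj_apply {u : Plane → ℂ} (x : Plane) (i : Fin 2) :
    grad (fun x => (starRingEnd ℂ) (u x)) x i = (starRingEnd ℂ) (grad u x i) := by
  simp only [grad_apply]
  have := Complex.conjCLE.comp_fderiv (f := u) (x := x)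
  have h2 : (fun x => (starRingEnd ℂ) (u x)) = Complex.conjCLE ∘ u := by
    ext x; simp
  rw [h2, this]; simp

lemma contDiff_conj {u : Plane → ℂ} (hu : ContDiff ℝ ∞ u) :
    ContDiff ℝ ∞ fun x => (starRingEnd ℂ) (u x) :=
  Complex.conjCLE.contDiff.comp hu

lemma hasCompactSupport_conj {u : Plane → ℂ} (hu : HasCompactSupport u) :
    HasCompactSupport fun x => (starRingEnd ℂ) (u x) :=
  hu.comp_left (g := starRingEnd ℂ) (map_zero _)

lemma memLp_component {G : Plane → EuclideanSpace ℂ (Fin 2)} {μ : Measure Plane}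
    (hG : MemLp G 2 μ) (i : Fin 2) : MemLp (fun x => G x i) 2 μ :=
  (EuclideanSpace.proj i : EuclideanSpace ℂ (Fin 2) →L[ℂ] ℂ).comp_memLp' hG

lemma hasCompactSupport_grad_apply {u : Plane → ℂ} (hu : HasCompactSupport u) (i : Fin 2) :
    HasCompactSupport fun x => grad u x i := by
  simp only [grad_apply]
  exact hu.fderiv_apply (𝕜 := ℝ) _

lemma memLp_conj {u : Plane → ℂ} {μ : Measure Plane} (hu : MemLp u 2 μ) :
    MemLp (fun x => (starRingEnd ℂ) (u x)) 2 μ := hu.star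

lemma integrable_mul_of_memLp {u v : Plane → ℂ} {μ : Measure Plane} (hu : MemLp u 2 μ)
    (hv : MemLp v 2 μ) : Integrable (fun x => u x * v x) μ := hu.integrable_mul hv

namespace Curve

variable (Γ : Curve)

lemma continuousOn : ContinuousOn Γ.γ (Icc 0 Γ.L) := Γ.contDiffOn.continuousOn

lemma aemeasurable : AEMeasurable Γ.γ (volume.restrict (Icc 0 Γ.L)) :=
  Γ.continuousOn.aemeasurable measurableSet_Icc

lemma isCompact_carrier : IsCompact Γ.carrier := isCompact_Icc.image_of_continuousOn Γ.continuousOn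

instance : IsFiniteMeasure Γ.sigma := by
  unfold sigma
  have : IsFiniteMeasure (volume.restrict (Icc 0 Γ.L)) := ⟨by simp⟩
  infer_instance

lemma ae_mem_carrier : ∀ᵐ x ∂Γ.sigma, x ∈ Γ.carrier := by
  unfold sigma
  refine (ae_map_iff Γ.aemeasurable (p := fun x => x ∈ Γ.carrier)
    Γ.isCompact_carrier.measurableSet).2 ?_
  filter_upwards [ae_restrict_mem measurableSet_Icc] with s hs using ⟨s, hs, rfl⟩

lemma memLp_of_continuous {f : Plane → ℂ} (hf : Continuous f) : MemLp f 2 Γ.sigma := by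
  obtain ⟨C, hC⟩ := Γ.isCompact_carrier.exists_bound_of_continuousOn hf.continuousOn
  refine MemLp.of_bound hf.aestronglyMeasurable C ?_
  filter_upwards [Γ.ae_mem_carrier] with x hx using hC x hx

end Curve

/-! ### The weak equation and its test functions -/

/-- Dilations of one bump by `n + 1 ≥ 1`: dilating only shrinks the gradient, and every fixed point
ends up inside the region where the function is constant. This is what dominated convergence needs.
-/
lemma exists_cutoff : ∃ (χ : ℕ → Plane → ℂ) (C : ℝ), (∀ n, ContDiff ℝ ∞ (χ n)) ∧
    (∀ n, HasCompactSupport (χ n)) ∧ (∀ n x, ‖χ n x‖ ≤ 1) ∧ (∀ n x i, ‖grad (χ n) x i‖ ≤ C) ∧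
    ∀ x, ∀ᶠ n in atTop, χ n x = 1 ∧ ∀ i, grad (χ n) x i = 0 := by
  let b : ContDiffBump (0 : Plane) := ⟨1, 2, by norm_num, by norm_num⟩
  let B : Plane → ℂ := fun x => ((b x : ℝ) : ℂ)
  have hB : ContDiff ℝ ∞ B := Complex.ofRealCLM.contDiff.comp b.contDiff
  have hBs : HasCompactSupport B := b.hasCompactSupport.comp_left (g := fun r : ℝ => (r : ℂ)) rfl
  obtain ⟨C, hC⟩ := (hB.continuous_fderiv (by simp)).bounded_above_of_compact_support
    (hBs.fderiv (𝕜 := ℝ))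
  have hpos : ∀ n : ℕ, (0 : ℝ) < ((n : ℝ) + 1)⁻¹ := fun n => by positivity
  have hle : ∀ n : ℕ, ((n : ℝ) + 1)⁻¹ ≤ 1 := fun n =>
    inv_le_one_of_one_le₀ (by have : (0 : ℝ) ≤ n := n.cast_nonneg; linarith)
  refine ⟨fun n x => B (((n : ℝ) + 1)⁻¹ • x), C, fun n => ?_, fun n => ?_, fun n x => ?_,
    fun n x i => ?_, fun x => ?_⟩
  · exact hB.comp (contDiff_const_smul _)
  · exact hBs.comp_homeomorph (Homeomorph.smulOfNeZero _ (hpos n).ne')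
  · simp only [B, Complex.norm_real, Real.norm_eq_abs, abs_of_nonneg b.nonneg]
    exact b.le_one
  · rw [grad_apply]
    have h1 : fderiv ℝ (fun x : Plane => B (((n : ℝ) + 1)⁻¹ • x)) x =
        ((n : ℝ) + 1)⁻¹ • fderiv ℝ B (((n : ℝ) + 1)⁻¹ • x) := by
      exact fderiv_comp_smul _
    rw [h1, smul_apply, norm_smul, Real.norm_eq_abs, abs_of_pos (hpos n)]
    have h2 : ‖fderiv ℝ B (((n : ℝ) + 1)⁻¹ • x) (EuclideanSpace.single i 1)‖ ≤ C := by
      refine ((fderiv ℝ B _).le_opNorm _).trans ?_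
      simpa using hC _
    calc _ ≤ 1 * C := mul_le_mul (hle n) h2 (norm_nonneg _) zero_le_one
      _ = C := one_mul _
  · obtain ⟨N, hN⟩ := exists_nat_gt ‖x‖
    filter_upwards [eventually_ge_atTop N] with n hn
    have hx : ‖x‖ < (n : ℝ) + 1 := by
      have : (N : ℝ) ≤ n := by exact_mod_cast hn
      linarith
    have hmem : ((n : ℝ) + 1)⁻¹ • x ∈ Metric.ball (0 : Plane) b.rIn := by
      rw [mem_ball_zero_iff, norm_smul, Real.norm_eq_abs, abs_of_pos (hpos n)]
      rw [inv_mul_lt_iff₀ (by positivity)]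
      simpa [b] using hx
    have hev : (fun x : Plane => B (((n : ℝ) + 1)⁻¹ • x)) =ᶠ[𝓝 x] fun _ => 1 := by
      have := (b.eventuallyEq_one_of_mem_ball hmem)
      have hc : ContinuousAt (fun x : Plane => ((n : ℝ) + 1)⁻¹ • x) x :=
        (continuous_const_smul _).continuousAt
      filter_upwards [hc.eventually this] with z hz
      simp [B, hz]
    refine ⟨hev.eq_of_nhds, fun i => ?_⟩
    rw [grad_apply, hev.fderiv_eq]
    simp

/-- If `F ∈ L²`, then integrals of `F` against cut off functions, and against their derivatives,
converge. -/
lemma tendsto_integral_cutoff {χ : ℕ → Plane → ℂ} {C : ℝ} (hχ : ∀ n, ContDiff ℝ ∞ (χ n))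
    (hχ1 : ∀ n x, ‖χ n x‖ ≤ 1) (hχ2 : ∀ n x i, ‖grad (χ n) x i‖ ≤ C)
    (hχ3 : ∀ x, ∀ᶠ n in atTop, χ n x = 1 ∧ ∀ i, grad (χ n) x i = 0)
    {F φ : Plane → ℂ} (hF : MemLp F 2 volume) (hφ : ContDiff ℝ ∞ φ) (hφ2 : MemLp φ 2 volume)
    (i : Fin 2) (hφ3 : MemLp (fun x => grad φ x i) 2 volume) :
    Tendsto (fun n => ∫ x, F x * grad (fun x => χ n x * φ x) x i) atTop
      (𝓝 (∫ x, F x * grad φ x i)) := by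
  have hg : ∀ n x, grad (fun x => χ n x * φ x) x i = χ n x * grad φ x i + φ x * grad (χ n) x i :=
    fun n x => grad_mul_apply ((hχ n).differentiable (by simp) x)
      (hφ.differentiable (by simp) x) i
  refine tendsto_integral_of_dominated_convergence
    (fun x => ‖F x * grad φ x i‖ + C * ‖F x * φ x‖) (fun n => ?_) ?_ (fun n => ?_) ?_
  · refine hF.aestronglyMeasurable.mul (Continuous.aestronglyMeasurable ?_)
    exact continuous_grad_apply ((hχ n).mul hφ) i
  · exact (integrable_mul_of_memLp hF hφ3).norm.add
      ((integrable_mul_of_memLp hF hφ2).norm.const_mul C)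
  · refine ae_of_all _ fun x => ?_
    rw [hg, mul_add]
    refine (norm_add_le _ _).trans (add_le_add ?_ ?_)
    · rw [norm_mul, norm_mul, norm_mul]
      have := hχ1 n x
      nlinarith [mul_nonneg (norm_nonneg (F x)) (norm_nonneg (grad φ x i)),
        mul_le_mul_of_nonneg_left this (mul_nonneg (norm_nonneg (F x)) (norm_nonneg (grad φ x i)))]
    · rw [norm_mul, norm_mul, norm_mul]
      nlinarith [mul_le_mul_of_nonneg_left (hχ2 n x i)
        (mul_nonneg (norm_nonneg (F x)) (norm_nonneg (φ x)))]
  · refine ae_of_all _ fun x => ?_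
    refine tendsto_const_nhds.congr' ?_
    filter_upwards [hχ3 x] with n hn
    rw [hg, hn.1, hn.2 i]; ring

lemma tendsto_integral_cutoff_mul {μ : Measure Plane} {χ : ℕ → Plane → ℂ}
    (hχ : ∀ n, ContDiff ℝ ∞ (χ n)) (hχ1 : ∀ n x, ‖χ n x‖ ≤ 1)
    (hχ3 : ∀ x, ∀ᶠ n in atTop, χ n x = 1 ∧ ∀ i, grad (χ n) x i = 0)
    {F φ : Plane → ℂ} (hF : MemLp F 2 μ) (hφ2 : MemLp φ 2 μ) :
    Tendsto (fun n => ∫ x, F x * (χ n x * φ x) ∂μ) atTop (𝓝 (∫ x, F x * φ x ∂μ)) := by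
  refine tendsto_integral_of_dominated_convergence
    (fun x => ‖F x * φ x‖) (fun n => ?_) ?_ (fun n => ?_) ?_
  · exact hF.aestronglyMeasurable.mul
      ((hχ n).continuous.aestronglyMeasurable.mul hφ2.aestronglyMeasurable)
  · exact (integrable_mul_of_memLp hF hφ2).norm
  · refine ae_of_all _ fun x => ?_
    rw [norm_mul, norm_mul, norm_mul]
    nlinarith [mul_le_mul_of_nonneg_left (hχ1 n x)
        (mul_nonneg (norm_nonneg (F x)) (norm_nonneg (φ x)))]
  · refine ae_of_all _ fun x => ?_
    refine tendsto_const_nhds.congr' ?_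
    filter_upwards [hχ3 x] with n hn
    rw [hn.1, one_mul]

/-- The weak form of the eigenvalue equation with eigenvalue `-κ²`, for the weak gradient `G` and
the trace `τ` of `ψ`. -/
structure WeakSolution (Γ : Curve) (α κ : ℝ) (ψ : Plane → ℂ)
    (G : Plane → EuclideanSpace ℂ (Fin 2)) (τ : Plane → ℂ) : Prop where
  sobolev : IsSobolev Γ ψ G τ
  weak : ∀ θ : Plane → ℂ, ContDiff ℝ ∞ θ → HasCompactSupport θ →
    (∑ i, ∫ x, G x i * grad θ x i) + (κ : ℂ) ^ 2 * ∫ x, ψ x * θ x =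
      (α : ℂ) * ∫ x, τ x * θ x ∂Γ.sigma

lemma memLp_of_test {φ : Plane → ℂ} (hφ : ContDiff ℝ ∞ φ) (hc : HasCompactSupport φ)
    (μ : Measure Plane) [IsFiniteMeasureOnCompacts μ] (p : ℝ≥0∞) : MemLp φ p μ :=
  hφ.continuous.memLp_of_hasCompactSupport hc

lemma memLp_grad_of_test {φ : Plane → ℂ} (hφ : ContDiff ℝ ∞ φ) (hc : HasCompactSupport φ) :
    MemLp (grad φ) 2 volume := by
  refine MemLp.of_eval_piLp fun i => ?_
  exact (continuous_grad_apply hφ i).memLp_of_hasCompactSupport (hasCompactSupport_grad_apply hc i)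

lemma isSobolev_of_test (Γ : Curve) {φ : Plane → ℂ} (hφ : ContDiff ℝ ∞ φ)
    (hc : HasCompactSupport φ) : IsSobolev Γ φ (grad φ) φ where
  memLp := memLp_of_test hφ hc _ _
  memLp_grad := memLp_grad_of_test hφ hc
  weakGradient := by
    intro θ hθ hθc i
    have h := integral_mul_fderiv_eq_neg_fderiv_mul_of_integrable (μ := (volume : Measure Plane))
      (f := φ) (g := θ) (v := EuclideanSpace.single i 1) (𝕜 := ℂ) ?_ ?_ ?_
      (fun x _ => hφ.differentiable (by simp) x) (fun x _ => hθ.differentiable (by simp) x)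
    · exact h
    · exact integrable_mul_of_memLp (memLp_component (memLp_grad_of_test hφ hc) i)
        (memLp_of_test hθ hθc _ _)
    · exact integrable_mul_of_memLp (memLp_of_test hφ hc _ _)
        (memLp_component (memLp_grad_of_test hθ hθc) i)
    · exact integrable_mul_of_memLp (memLp_of_test hφ hc _ _) (memLp_of_test hθ hθc _ _)
  trace := by
    refine ⟨memLp_of_test hφ hc _ _, fun _ => φ, fun _ => ⟨hφ, hc⟩, ?_, ?_, ?_⟩ <;> simp

/-- Testing the form with `conj θ` removes the conjugations, so the equation becomes bilinear. -/
lemma exists_weakSolution {Γ : Curve} {α κ : ℝ} {ψ : Plane → ℂ}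
    (h : IsEigenfunction Γ α (-κ ^ 2) ψ) : ∃ G τ, WeakSolution Γ α κ ψ G τ := by
  obtain ⟨⟨-, G, τ, hS, hw⟩, -⟩ := h
  refine ⟨G, τ, hS, fun θ hθ hc => ?_⟩
  have h1 := hw _ _ _ (isSobolev_of_test Γ (contDiff_conj hθ) (hasCompactSupport_conj hc))
  simp only [formValue, grad_conj_apply, Complex.conj_conj] at h1
  rw [integral_finsetSum] at h1
  · have h2 : ∫ x, ((-κ ^ 2 : ℝ) : ℂ) * ψ x * θ x = -((κ : ℂ) ^ 2 * ∫ x, ψ x * θ x) := by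
      rw [← integral_const_mul, ← integral_neg]
      congr 1; ext x; push_cast; ring
    rw [h2] at h1
    linear_combination h1
  · intro i _
    exact integrable_mul_of_memLp (memLp_component hS.memLp_grad i)
      (memLp_component (memLp_grad_of_test hθ hc) i)

namespace WeakSolution

variable {Γ : Curve} {α κ : ℝ} {ψ : Plane → ℂ} {G : Plane → EuclideanSpace ℂ (Fin 2)}
  {τ : Plane → ℂ}

lemma weakGradient_of_memLp (h : WeakSolution Γ α κ ψ G τ) {φ : Plane → ℂ}
    (hφ : ContDiff ℝ ∞ φ) (hφ2 : MemLp φ 2 volume) (i : Fin 2)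
    (hφ3 : MemLp (fun x => grad φ x i) 2 volume) :
    ∫ x, ψ x * grad φ x i = - ∫ x, G x i * φ x := by
  obtain ⟨χ, C, h1, h2, h3, h4, h5⟩ := exists_cutoff
  have e1 := tendsto_integral_cutoff h1 h3 h4 h5 h.sobolev.memLp hφ hφ2 i hφ3
  have e2 := (tendsto_integral_cutoff_mul h1 h3 h5
    (memLp_component h.sobolev.memLp_grad i) hφ2).neg
  refine tendsto_nhds_unique e1 (e2.congr fun n => ?_)
  exact (h.sobolev.weakGradient _ ((h1 n).mul hφ) (h2 n).mul_right i).symm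

/-- The heat kernel has no compact support, so the equation is extended by cutting off. On the
curve, which is compact, no decay of the test function is needed. -/
lemma weak_of_memLp (h : WeakSolution Γ α κ ψ G τ) {φ : Plane → ℂ}
    (hφ : ContDiff ℝ ∞ φ) (hφ2 : MemLp φ 2 volume)
    (hφ3 : ∀ i, MemLp (fun x => grad φ x i) 2 volume) :
    (∑ i, ∫ x, G x i * grad φ x i) + (κ : ℂ) ^ 2 * ∫ x, ψ x * φ x =
      (α : ℂ) * ∫ x, τ x * φ x ∂Γ.sigma := by
  obtain ⟨χ, C, h1, h2, h3, h4, h5⟩ := exists_cutoff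
  have e1 := tendsto_finsetSum Finset.univ fun i _ => tendsto_integral_cutoff h1 h3 h4 h5
    (memLp_component h.sobolev.memLp_grad i) hφ hφ2 i (hφ3 i)
  have e2 := (tendsto_integral_cutoff_mul h1 h3 h5 h.sobolev.memLp hφ2).const_mul ((κ : ℂ) ^ 2)
  have e3 := (tendsto_integral_cutoff_mul h1 h3 h5 h.sobolev.trace.1
    (Γ.memLp_of_continuous hφ.continuous)).const_mul (α : ℂ)
  refine tendsto_nhds_unique (e1.add e2) (e3.congr fun n => ?_)
  exact (h.weak _ ((h1 n).mul hφ) (h2 n).mul_right).symm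

/-- The eigenvalue equation in very weak form. -/
lemma very_weak (h : WeakSolution Γ α κ ψ G τ) {φ : Plane → ℂ} {φ' φ'' : Fin 2 → Plane → ℂ}
    (hφ : ContDiff ℝ ∞ φ) (hφ2 : MemLp φ 2 volume)
    (h1 : ∀ i x, grad φ x i = φ' i x) (h1s : ∀ i, ContDiff ℝ ∞ (φ' i))
    (h1m : ∀ i, MemLp (φ' i) 2 volume)
    (h2 : ∀ i x, grad (φ' i) x i = φ'' i x) (h2m : ∀ i, MemLp (φ'' i) 2 volume) :
    ∫ x, ψ x * ∑ i, φ'' i x = (κ : ℂ) ^ 2 * (∫ x, ψ x * φ x) -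
      (α : ℂ) * ∫ x, τ x * φ x ∂Γ.sigma := by
  have e := h.weak_of_memLp hφ hφ2 fun i => by simpa only [h1] using h1m i
  simp only [Finset.mul_sum]
  rw [integral_finsetSum _ fun i _ => integrable_mul_of_memLp h.sobolev.memLp (h2m i)]
  have e2 : ∀ i, ∫ x, ψ x * φ'' i x = - ∫ x, G x i * grad φ x i := by
    intro i
    simp only [h1, ← h2]
    exact h.weakGradient_of_memLp (h1s i) (h1m i) i (by simpa only [h2] using h2m i)
  simp only [e2, Finset.sum_neg_distrib]
  linear_combination -e

end WeakSolution

/-! ### The heat kernel and its Gaussian bounds -/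

/-- The heat kernel of the plane. -/
def heat (t : ℝ) (z : Plane) : ℝ := (4 * Real.pi * t)⁻¹ * Real.exp (-‖z‖ ^ 2 / (4 * t))

/-- The time derivative of the heat kernel. -/
def heatDeriv (t : ℝ) (z : Plane) : ℝ := (‖z‖ ^ 2 / (4 * t ^ 2) - 1 / t) * heat t z

lemma heat_nonneg {t : ℝ} (ht : 0 ≤ t) (z : Plane) : 0 ≤ heat t z := by
  unfold heat; positivity

lemma contDiff_heat (t : ℝ) : ContDiff ℝ ∞ (heat t) := by
  unfold heat
  exact contDiff_const.mul (((contDiff_norm_sq ℝ).neg.div_const _).exp)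

lemma hasFDerivAt_heat (t : ℝ) (z : Plane) :
    HasFDerivAt (heat t) ((-(heat t z / (2 * t))) • innerSL ℝ z) z := by
  have h1 : HasFDerivAt (fun z : Plane => ‖z‖ ^ 2) (2 • innerSL ℝ z) z :=
    (hasStrictFDerivAt_norm_sq z).hasFDerivAt
  have h2 := ((h1.const_mul (-(1 / (4 * t)))).exp).const_mul ((4 * Real.pi * t)⁻¹)
  have e : heat t = fun z : Plane => (4 * Real.pi * t)⁻¹ * Real.exp (-(1 / (4 * t)) * ‖z‖ ^ 2) := by
    ext z; unfold heat; congr 2; ring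
  rw [e]
  refine h2.congr_fderiv ?_
  ext w
  simp
  ring

lemma hasDerivAt_heat {t : ℝ} (ht : 0 < t) (z : Plane) :
    HasDerivAt (fun t => heat t z) (heatDeriv t z) t := by
  have h0 : t ≠ 0 := ht.ne'
  have hp := Real.pi_pos
  have h1 : HasDerivAt (fun t : ℝ => 4 * Real.pi * t) (4 * Real.pi) t := by
    simpa using (hasDerivAt_id t).const_mul (4 * Real.pi)
  have h2 : HasDerivAt (fun t : ℝ => 4 * t) 4 t := by
    simpa using (hasDerivAt_id t).const_mul 4
  have h3 := (h1.inv (by positivity)).mul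
    (((hasDerivAt_const t (-‖z‖ ^ 2)).div h2 (by positivity)).exp)
  unfold heat
  refine h3.congr_deriv ?_
  simp only [heatDeriv, heat, Pi.inv_apply, Pi.div_apply]
  field_simp
  ring

lemma grad_ofReal {f : Plane → ℝ} {f' : Plane →L[ℝ] ℝ} {x : Plane} (h : HasFDerivAt f f' x)
    (i : Fin 2) : grad (fun y => (f y : ℂ)) x i = (f' (EuclideanSpace.single i 1) : ℝ) := by
  rw [grad_apply]
  have : HasFDerivAt (fun y => (f y : ℂ)) (Complex.ofRealCLM.comp f') x :=
    Complex.ofRealCLM.hasFDerivAt.comp x h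
  rw [this.fderiv]
  simp

lemma hasFDerivAt_heat_sub (t : ℝ) (x y : Plane) :
    HasFDerivAt (fun y => heat t (x - y)) ((heat t (x - y) / (2 * t)) • innerSL ℝ (x - y)) y := by
  have h := (hasFDerivAt_heat t (x - y)).comp y ((hasFDerivAt_id y).const_sub x)
  refine h.congr_fderiv ?_
  ext w
  simp

lemma innerSL_single (z : Plane) (i : Fin 2) :
    innerSL ℝ z (EuclideanSpace.single i (1 : ℝ)) = z i := by
  simp [EuclideanSpace.inner_single_right]

lemma grad_heat_sub (t : ℝ) (x y : Plane) (i : Fin 2) :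
    grad (fun y => ((heat t (x - y) : ℝ) : ℂ)) y i =
      (((x - y) i / (2 * t) * heat t (x - y) : ℝ) : ℂ) := by
  rw [grad_ofReal (hasFDerivAt_heat_sub t x y), smul_apply, innerSL_single, smul_eq_mul]
  congr 1; ring

lemma grad_grad_heat_sub (t : ℝ) (x y : Plane) (i : Fin 2) :
    grad (fun y => (((x - y) i / (2 * t) * heat t (x - y) : ℝ) : ℂ)) y i =
      ((((x - y) i ^ 2 / (4 * t ^ 2) - 1 / (2 * t)) * heat t (x - y) : ℝ) : ℂ) := by
  have h1 : HasFDerivAt (fun y : Plane => (x - y) i / (2 * t))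
      ((-(1 / (2 * t))) • (EuclideanSpace.proj i : Plane →L[ℝ] ℝ)) y := by
    have h2 := (((EuclideanSpace.proj i : Plane →L[ℝ] ℝ).hasFDerivAt).comp y
      ((hasFDerivAt_id y).const_sub x)).mul_const (1 / (2 * t))
    refine (h2.congr_fderiv ?_).congr_of_eventuallyEq (Eventually.of_forall fun z => ?_)
    · ext w; simp
    · simp; ring
  refine (grad_ofReal (h1.mul (hasFDerivAt_heat_sub t x y)) i).trans ?_
  congr 1
  simp only [add_apply, smul_apply, innerSL_single, smul_eq_mul]
  simp
  ring

lemma sum_second_deriv_heat (t : ℝ) (z : Plane) :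
    ∑ i : Fin 2, (z i ^ 2 / (4 * t ^ 2) - 1 / (2 * t)) * heat t z = heatDeriv t z := by
  simp only [Fin.sum_univ_two, heatDeriv, EuclideanSpace.norm_sq_eq, Real.norm_eq_abs, sq_abs]
  ring

lemma integrable_gaussian {b : ℝ} (hb : 0 < b) :
    Integrable fun z : Plane => Real.exp (-b * ‖z‖ ^ 2) := by
  have h := (GaussianFourier.integrable_cexp_neg_mul_sq_norm_add (V := Plane)
    (b := (b : ℂ)) (by simpa using hb) 0 0).norm
  refine h.congr (ae_of_all _ fun z => ?_)
  simp only [Complex.norm_exp]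
  congr 1
  simp [← Complex.ofReal_pow]

lemma integral_gaussian_plane {b : ℝ} (hb : 0 < b) :
    ∫ z : Plane, Real.exp (-b * ‖z‖ ^ 2) = Real.pi / b := by
  rw [GaussianFourier.integral_rexp_neg_mul_sq_norm hb]
  simp

lemma heat_eq (t : ℝ) (z : Plane) :
    heat t z = (4 * Real.pi * t)⁻¹ * Real.exp (-(1 / (4 * t)) * ‖z‖ ^ 2) := by
  unfold heat; congr 2; ring

lemma integrable_heat {t : ℝ} (ht : 0 < t) : Integrable (heat t) := by
  simp only [funext (heat_eq t)]
  exact (integrable_gaussian (by positivity)).const_mul _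

lemma integral_heat {t : ℝ} (ht : 0 < t) : ∫ z, heat t z = 1 := by
  simp only [heat_eq]
  have := Real.pi_pos
  rw [integral_const_mul, integral_gaussian_plane (by positivity)]
  field_simp

lemma heat_sq (t : ℝ) (z : Plane) :
    heat t z ^ 2 = ((4 * Real.pi * t)⁻¹) ^ 2 * Real.exp (-(1 / (2 * t)) * ‖z‖ ^ 2) := by
  rw [heat_eq, mul_pow, ← Real.exp_nat_mul]
  congr 2; push_cast; ring

lemma integrable_heat_sq {t : ℝ} (ht : 0 < t) : Integrable fun z => heat t z ^ 2 := by
  simp only [heat_sq]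
  exact (integrable_gaussian (by positivity)).const_mul _

lemma integral_heat_sq {t : ℝ} (ht : 0 < t) : ∫ z, heat t z ^ 2 = (8 * Real.pi * t)⁻¹ := by
  simp only [heat_sq]
  have := Real.pi_pos
  rw [integral_const_mul, integral_gaussian_plane (by positivity)]
  field_simp
  norm_num

lemma memLp_of_gaussian_bound {f : Plane → ℂ} (hf : Continuous f) {b C : ℝ} (hb : 0 < b)
    (x : Plane) (h : ∀ y, ‖f y‖ ≤ C * Real.exp (-b * ‖x - y‖ ^ 2)) : MemLp f 2 volume := by
  have h1 : MemLp (fun y => C * Real.exp (-b * ‖x - y‖ ^ 2)) 2 volume := by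
    refine MemLp.const_mul ?_ C
    rw [memLp_two_iff_integrable_sq (by fun_prop)]
    have := (integrable_gaussian (b := 2 * b) (by positivity)).comp_sub_left x
    refine this.congr (ae_of_all _ fun y => ?_)
    simp only
    rw [← Real.exp_nat_mul]
    congr 1; push_cast; ring
  exact h1.of_le hf.aestronglyMeasurable (ae_of_all _ fun y => (h y).trans (le_abs_self _))

lemma mul_exp_neg_le_one (a : ℝ) : a * Real.exp (-a) ≤ 1 := by
  rw [Real.exp_neg, ← div_eq_mul_inv, div_le_one (Real.exp_pos _)]
  linarith [Real.add_one_le_exp a]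

/-- Half of the exponent absorbs the square, by `a * exp (-a) ≤ 1`. -/
lemma sq_mul_gaussian_le {b : ℝ} (hb : 0 < b) (r : ℝ) :
    r ^ 2 * Real.exp (-(2 * b) * r ^ 2) ≤ b⁻¹ * Real.exp (-b * r ^ 2) := by
  have h1 := mul_exp_neg_le_one (b * r ^ 2)
  have h2 : Real.exp (-(2 * b) * r ^ 2) = Real.exp (-(b * r ^ 2)) * Real.exp (-b * r ^ 2) := by
    rw [← Real.exp_add]; congr 1; ring
  rw [h2, ← mul_assoc]
  refine mul_le_mul_of_nonneg_right ?_ (Real.exp_nonneg _)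
  rw [← one_div, le_div_iff₀ hb]
  linarith

/-- A bound for `heat` and its derivatives, locally uniformly in time. -/
lemma heat_mul_le {t₀ t : ℝ} (h0 : 0 < t₀) (h1 : t₀ ≤ 2 * t) (h2 : t ≤ 2 * t₀) {a b : ℝ}
    (ha : 0 ≤ a) (hb : 0 ≤ b) (z : Plane) :
    (a * ‖z‖ ^ 2 + b) * heat t z ≤
      (2 * Real.pi * t₀)⁻¹ * (a * (16 * t₀) + b) * Real.exp (-(1 / (16 * t₀)) * ‖z‖ ^ 2) := by
  have ht : 0 < t := by linarith
  have hp := Real.pi_pos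
  have e1 : (4 * Real.pi * t)⁻¹ ≤ (2 * Real.pi * t₀)⁻¹ := by
    apply inv_anti₀ (by positivity); nlinarith
  have e2 : Real.exp (-(1 / (4 * t)) * ‖z‖ ^ 2) ≤
      Real.exp (-(2 * (1 / (16 * t₀))) * ‖z‖ ^ 2) := by
    apply Real.exp_le_exp.2
    apply mul_le_mul_of_nonneg_right _ (by positivity)
    rw [neg_le_neg_iff, mul_one_div, div_le_div_iff₀ (by positivity) (by positivity)]
    linarith
  -- From `t ≤ 2 t₀` the decay rate is at least `1/(8 t₀) = 2 · 1/(16 t₀)`; one half of it will be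
  -- spent on the factor `‖z‖²`.
  have e3 : heat t z ≤ (2 * Real.pi * t₀)⁻¹ * Real.exp (-(2 * (1 / (16 * t₀))) * ‖z‖ ^ 2) := by
    rw [heat_eq]; gcongr
  have e4 := sq_mul_gaussian_le (b := 1 / (16 * t₀)) (by positivity) ‖z‖
  have e5 : Real.exp (-(2 * (1 / (16 * t₀))) * ‖z‖ ^ 2) ≤
      Real.exp (-(1 / (16 * t₀)) * ‖z‖ ^ 2) := by
    apply Real.exp_le_exp.2
    apply mul_le_mul_of_nonneg_right _ (by positivity)
    have : 0 < 1 / (16 * t₀) := by positivity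
    linarith
  rw [one_div, inv_inv] at e4
  simp only [← one_div (16 * t₀)] at e4
  calc _ ≤ (a * ‖z‖ ^ 2 + b) *
        ((2 * Real.pi * t₀)⁻¹ * Real.exp (-(2 * (1 / (16 * t₀))) * ‖z‖ ^ 2)) := by gcongr
    _ = (2 * Real.pi * t₀)⁻¹ * (a * (‖z‖ ^ 2 * Real.exp (-(2 * (1 / (16 * t₀))) * ‖z‖ ^ 2)) +
        b * Real.exp (-(2 * (1 / (16 * t₀))) * ‖z‖ ^ 2)) := by ring
    _ ≤ (2 * Real.pi * t₀)⁻¹ * (a * (16 * t₀ * Real.exp (-(1 / (16 * t₀)) * ‖z‖ ^ 2)) +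
        b * Real.exp (-(1 / (16 * t₀)) * ‖z‖ ^ 2)) := by gcongr
    _ = _ := by ring

lemma memLp_heat_of_le {p : Plane → ℝ} (hp : Continuous p) {t : ℝ} (ht : 0 < t) {a b : ℝ}
    (ha : 0 ≤ a) (hb : 0 ≤ b) (h : ∀ z, |p z| ≤ a * ‖z‖ ^ 2 + b) (x : Plane) :
    MemLp (fun y => ((p (x - y) * heat t (x - y) : ℝ) : ℂ)) 2 volume := by
  refine memLp_of_gaussian_bound (b := 1 / (16 * t))
    (C := (2 * Real.pi * t)⁻¹ * (a * (16 * t) + b)) ?_ (by positivity) x fun y => ?_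
  · have := (contDiff_heat t).continuous
    fun_prop
  · rw [Complex.norm_real, norm_mul, Real.norm_eq_abs, Real.norm_eq_abs,
      abs_of_nonneg (heat_nonneg ht.le _)]
    exact (mul_le_mul_of_nonneg_right (h _) (heat_nonneg ht.le _)).trans
      (heat_mul_le ht (by linarith) (by linarith) ha hb _)

lemma memLp_heat {t : ℝ} (ht : 0 < t) (x : Plane) :
    MemLp (fun y => ((heat t (x - y) : ℝ) : ℂ)) 2 volume := by
  have := memLp_heat_of_le (p := fun _ => 1) continuous_const ht le_rfl zero_le_one
    (fun z => by simp) x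
  simpa using this

lemma abs_coord_le_norm (z : Plane) (i : Fin 2) : |z i| ≤ ‖z‖ := by
  simpa using PiLp.norm_apply_le z i

lemma abs_heatDeriv_le {t : ℝ} (ht : 0 < t) (z : Plane) :
    |heatDeriv t z| ≤ (1 / (4 * t ^ 2) * ‖z‖ ^ 2 + 1 / t) * heat t z := by
  unfold heatDeriv
  rw [abs_mul, abs_of_nonneg (heat_nonneg ht.le z)]
  refine mul_le_mul_of_nonneg_right ?_ (heat_nonneg ht.le z)
  refine (abs_sub _ _).trans ?_
  rw [abs_of_nonneg (by positivity), abs_of_nonneg (by positivity)]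
  apply le_of_eq; ring

lemma continuous_heatDeriv (t : ℝ) : Continuous (heatDeriv t) := by
  unfold heatDeriv
  have := (contDiff_heat t).continuous
  fun_prop

/-! ### The heat flow of a solution -/

/-- The convolution of `ψ` with the heat kernel. -/
def heatConv (μ : Measure Plane) (ψ : Plane → ℂ) (t : ℝ) (x : Plane) : ℂ :=
  ∫ y, ψ y * (heat t (x - y) : ℝ) ∂μ

lemma hasDerivAt_heatConv {ψ : Plane → ℂ} (hψ : MemLp ψ 2 volume) {t : ℝ} (ht : 0 < t)
    (x : Plane) : HasDerivAt (fun t => heatConv volume ψ t x)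
      (∫ y, ψ y * (heatDeriv t (x - y) : ℝ)) t := by
  have hps := Real.pi_pos
  -- The bound of `heat_mul_le` for `heatDeriv s`, valid for all `s` in `(t/2, 2t)`: there `1/(4s²)
  -- ≤ 1/t²` and `1/s ≤ 2/t`.
  let C := (2 * Real.pi * t)⁻¹ * (1 / t ^ 2 * (16 * t) + 2 / t)
  have hint : ∀ t > 0, Integrable fun y => ψ y * ((heat t (x - y) : ℝ) : ℂ) := fun t ht =>
    integrable_mul_of_memLp hψ (memLp_heat ht x)
  have key := hasDerivAt_integral_of_dominated_loc_of_deriv_le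
    (μ := (volume : Measure Plane)) (𝕜 := ℝ)
    (F := fun t y => ψ y * ((heat t (x - y) : ℝ) : ℂ))
    (F' := fun t y => ψ y * ((heatDeriv t (x - y) : ℝ) : ℂ)) (x₀ := t) (s := Ioo (t / 2) (2 * t))
    (bound := fun y => ‖ψ y * ((C * Real.exp (-(1 / (16 * t)) * ‖x - y‖ ^ 2) : ℝ) : ℂ)‖)
    (Ioo_mem_nhds (by linarith) (by linarith)) ?_ (hint t ht) ?_ ?_ ?_ ?_
  · exact key.2
  · filter_upwards [Ioi_mem_nhds ht] with s hs using (hint s hs).aestronglyMeasurable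
  · refine hψ.aestronglyMeasurable.mul (Continuous.aestronglyMeasurable ?_)
    have := continuous_heatDeriv t
    fun_prop
  · refine ae_of_all _ fun y s hs => ?_
    have hs0 : 0 < s := by linarith [hs.1]
    rw [norm_mul, norm_mul]
    refine mul_le_mul_of_nonneg_left ?_ (norm_nonneg _)
    rw [Complex.norm_real, Complex.norm_real, Real.norm_eq_abs, Real.norm_eq_abs]
    refine (abs_heatDeriv_le hs0 _).trans (le_trans ?_ (le_abs_self _))
    refine le_trans ?_ (heat_mul_le ht (by linarith [hs.1]) (by linarith [hs.2])
      (by positivity) (by positivity) (x - y))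
    refine mul_le_mul_of_nonneg_right ?_ (heat_nonneg hs0.le _)
    have e1 : 1 / (4 * s ^ 2) ≤ 1 / t ^ 2 := by
      apply one_div_le_one_div_of_le (by positivity)
      nlinarith [hs.1]
    have e2 : 1 / s ≤ 2 / t := by
      rw [div_le_div_iff₀ hs0 ht]; linarith [hs.1]
    gcongr
  · refine (integrable_mul_of_memLp hψ ?_).norm
    refine memLp_of_gaussian_bound (b := 1 / (16 * t)) (C := C) (by fun_prop) (by positivity) x
      fun y => ?_
    rw [Complex.norm_real, Real.norm_eq_abs, abs_of_nonneg (by positivity)]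
  · refine ae_of_all _ fun y s hs => ?_
    have hs0 : 0 < s := by linarith [hs.1]
    exact ((hasDerivAt_heat hs0 (x - y)).ofReal_comp).const_mul (ψ y)

/-- Boundedness for large times suffices, since the factor `e^{-κ²t}` then gives the limit `0` at
infinity. -/
lemma norm_heatConv_le {ψ : Plane → ℂ} (hψ : MemLp ψ 2 volume) {t : ℝ} (ht : 1 ≤ t) (x : Plane) :
    ‖heatConv volume ψ t x‖ ≤ (∫ y, ‖ψ y‖ ^ 2) + 1 := by
  have hp := Real.pi_gt_three
  have ht0 : 0 < t := by linarith
  have i1 : Integrable fun y => ‖ψ y‖ ^ 2 :=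
    (memLp_two_iff_integrable_sq_norm hψ.aestronglyMeasurable).1 hψ
  have i2 : Integrable fun y => heat t (x - y) ^ 2 := (integrable_heat_sq ht0).comp_sub_left x
  have h1 : ∫ y, heat t (x - y) ^ 2 = (8 * Real.pi * t)⁻¹ := by
    rw [integral_sub_left_eq_self (fun y => heat t y ^ 2), integral_heat_sq ht0]
  have h2 : (8 * Real.pi * t)⁻¹ ≤ 1 := inv_le_one_of_one_le₀ (by nlinarith)
  calc _ ≤ ∫ y, ‖ψ y * (heat t (x - y) : ℝ)‖ := norm_integral_le_integral_norm _
    _ ≤ ∫ y, (‖ψ y‖ ^ 2 + heat t (x - y) ^ 2) := by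
      refine integral_mono (integrable_mul_of_memLp hψ (memLp_heat ht0 x)).norm (i1.add i2) ?_
      intro y
      simp only [norm_mul, Complex.norm_real, Real.norm_eq_abs,
        abs_of_nonneg (heat_nonneg ht0.le _)]
      nlinarith [sq_nonneg (‖ψ y‖ - heat t (x - y)), sq_nonneg (‖ψ y‖ + heat t (x - y))]
    _ = _ := by rw [integral_add i1 i2]
    _ ≤ _ := by linarith

namespace WeakSolution

variable {Γ : Curve} {α κ : ℝ} {ψ : Plane → ℂ} {G : Plane → EuclideanSpace ℂ (Fin 2)}
  {τ : Plane → ℂ}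

/-- The heat equation: the second derivatives of `heat t (x - ·)` add up to `heatDeriv`, so this is
the very weak eigenvalue equation tested with the heat kernel. -/
lemma integral_mul_heatDeriv (h : WeakSolution Γ α κ ψ G τ) {t : ℝ} (ht : 0 < t) (x : Plane) :
    ∫ y, ψ y * (heatDeriv t (x - y) : ℝ) =
      (κ : ℂ) ^ 2 * heatConv volume ψ t x - (α : ℂ) * heatConv Γ.sigma τ t x := by
  have hc : ContDiff ℝ ∞ fun y => heat t (x - y) :=
    (contDiff_heat t).comp (contDiff_const.sub contDiff_id)
  have hci : ∀ i : Fin 2, ContDiff ℝ ∞ fun y : Plane => (x - y) i / (2 * t) := fun i =>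
    (((EuclideanSpace.proj i : Plane →L[ℝ] ℝ).contDiff).comp
      (contDiff_const.sub contDiff_id)).div_const _
  have key := h.very_weak (φ := fun y => ((heat t (x - y) : ℝ) : ℂ))
    (φ' := fun i y => (((x - y) i / (2 * t) * heat t (x - y) : ℝ) : ℂ))
    (φ'' := fun i y => ((((x - y) i ^ 2 / (4 * t ^ 2) - 1 / (2 * t)) * heat t (x - y) : ℝ) : ℂ))
    (Complex.ofRealCLM.contDiff.comp hc) (memLp_heat ht x)
    (fun i y => grad_heat_sub t x y i)
    (fun i => Complex.ofRealCLM.contDiff.comp ((hci i).mul hc))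
    (fun i => memLp_heat_of_le (p := fun z => z i / (2 * t)) (by fun_prop) ht
      (a := 1 / (2 * t)) (b := 1 / (2 * t)) (by positivity) (by positivity) (fun z => ?_) x)
    (fun i y => grad_grad_heat_sub t x y i)
    (fun i => memLp_heat_of_le (p := fun z => z i ^ 2 / (4 * t ^ 2) - 1 / (2 * t)) (by fun_prop) ht
      (a := 1 / (4 * t ^ 2)) (b := 1 / (2 * t)) (by positivity) (by positivity) (fun z => ?_) x)
  · simp only [← Complex.ofReal_sum, sum_second_deriv_heat] at key
    exact key
  · rw [abs_div, abs_of_pos (show 0 < 2 * t by positivity)]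
    have := abs_coord_le_norm z i
    rw [div_mul_eq_mul_div, ← add_div]
    gcongr
    nlinarith [norm_nonneg z, sq_nonneg (‖z‖ - 1)]
  · refine (abs_sub _ _).trans ?_
    rw [abs_of_nonneg (by positivity), abs_of_nonneg (by positivity)]
    have : z i ^ 2 ≤ ‖z‖ ^ 2 := by
      rw [← sq_abs (z i)]
      exact pow_le_pow_left₀ (abs_nonneg _) (abs_coord_le_norm z i) 2
    rw [div_mul_eq_mul_div, one_mul]
    gcongr

lemma hasDerivAt_exp_mul_heatConv (h : WeakSolution Γ α κ ψ G τ) {t : ℝ} (ht : 0 < t)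
    (x : Plane) :
    HasDerivAt (fun t : ℝ => (Real.exp (-κ ^ 2 * t) : ℂ) * heatConv volume ψ t x)
      (-((α : ℂ) * ((Real.exp (-κ ^ 2 * t) : ℂ) * heatConv Γ.sigma τ t x))) t := by
  have h1 : HasDerivAt (fun t : ℝ => Real.exp (-κ ^ 2 * t))
      (Real.exp (-κ ^ 2 * t) * (-κ ^ 2)) t := by
    have := ((hasDerivAt_id t).const_mul (-κ ^ 2)).exp
    simpa using this
  refine (h1.ofReal_comp.mul (hasDerivAt_heatConv h.sobolev.memLp ht x)).congr_deriv ?_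
  rw [h.integral_mul_heatDeriv ht x]
  push_cast
  ring

end WeakSolution

/-! ### Curvature estimates and Gaussian integrals along the curve -/

namespace Curve

variable (Γ : Curve)

lemma uniqueDiffOn : UniqueDiffOn ℝ (Icc 0 Γ.L) := uniqueDiffOn_Icc Γ.L_pos

lemma norm_tangent {s : ℝ} (hs : s ∈ Icc 0 Γ.L) : ‖Γ.tangent s‖ = 1 := Γ.unit_speed s hs

lemma bddAbove_curvature :
    BddAbove ((fun s => ‖iteratedDerivWithin 2 Γ.γ (Icc 0 Γ.L) s‖) '' Icc 0 Γ.L) :=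
  isCompact_Icc.bddAbove_image
    (Γ.contDiffOn.continuousOn_iteratedDerivWithin (by norm_num) Γ.uniqueDiffOn).norm

lemma curvature_le_K {s : ℝ} (hs : s ∈ Icc 0 Γ.L) :
    ‖iteratedDerivWithin 2 Γ.γ (Icc 0 Γ.L) s‖ ≤ Γ.K :=
  le_csSup Γ.bddAbove_curvature ⟨s, hs, rfl⟩

lemma K_nonneg : 0 ≤ Γ.K :=
  (norm_nonneg _).trans (Γ.curvature_le_K (left_mem_Icc.2 Γ.L_pos.le))

lemma norm_tangent_sub_le {s s' : ℝ} (hs : s ∈ Icc 0 Γ.L) (hs' : s' ∈ Icc 0 Γ.L) :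
    ‖Γ.tangent s - Γ.tangent s'‖ ≤ Γ.K * |s - s'| := by
  have h1 : DifferentiableOn ℝ Γ.tangent (Icc 0 Γ.L) :=
    (Γ.contDiffOn.derivWithin Γ.uniqueDiffOn (m := 1) (by norm_num)).differentiableOn (by norm_num)
  refine (convex_Icc 0 Γ.L).norm_image_sub_le_of_norm_derivWithin_le h1 (fun x hx => ?_) hs' hs
  have h2 := Γ.curvature_le_K hx
  rw [iteratedDerivWithin_succ] at h2
  have : iteratedDerivWithin 1 Γ.γ (Icc 0 Γ.L) = Γ.tangent := by
    ext1 y; rw [iteratedDerivWithin_one]; rfl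
  rwa [this] at h2

/-- Mean value inequality for `r ↦ γ r - r • tangent s'`, whose derivative is at most `K |s - s'|`.
The factor `1/2` of Taylor's formula is given up. -/
lemma norm_sub_sub_smul_tangent_le {s s' : ℝ} (hs : s ∈ Icc 0 Γ.L) (hs' : s' ∈ Icc 0 Γ.L) :
    ‖Γ.γ s - Γ.γ s' - (s - s') • Γ.tangent s'‖ ≤ Γ.K * |s - s'| ^ 2 := by
  have hsub : uIcc s' s ⊆ Icc 0 Γ.L := ordConnected_Icc.uIcc_subset hs' hs
  have hd : ∀ x ∈ uIcc s' s, HasDerivWithinAt (fun r => Γ.γ r - r • Γ.tangent s')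
      (Γ.tangent x - Γ.tangent s') (uIcc s' s) x := by
    intro x hx
    have h1 : HasDerivWithinAt Γ.γ (Γ.tangent x) (Icc 0 Γ.L) x :=
      (Γ.contDiffOn.differentiableOn (by norm_num) x (hsub hx)).hasDerivWithinAt
    have h2 : HasDerivWithinAt (fun r : ℝ => r • Γ.tangent s') (Γ.tangent s') (uIcc s' s) x := by
      simpa using ((hasDerivAt_id x).smul_const (Γ.tangent s')).hasDerivWithinAt
    exact (h1.mono hsub).sub h2
  have h3 := (convex_uIcc s' s).norm_image_sub_le_of_norm_hasDerivWithin_le (C := Γ.K * |s - s'|)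
    hd (fun x hx => ?_) left_mem_uIcc right_mem_uIcc
  · rw [Real.norm_eq_abs] at h3
    refine le_trans (le_of_eq ?_) (h3.trans (le_of_eq ?_))
    · congr 1; rw [sub_smul]; abel
    · ring
  · refine (Γ.norm_tangent_sub_le (hsub hx) hs').trans ?_
    refine mul_le_mul_of_nonneg_left ?_ Γ.K_nonneg
    exact abs_sub_left_of_mem_uIcc hx

/-- A local chord-arc bound from the curvature alone: by Taylor, `|s - s'|` exceeds the chord by at
most `K |s - s'|² ≤ |s - s'| / 2`. It makes the representation of `ψ` independent of `M`, whose
positivity is not known at that stage. -/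
lemma abs_sub_le_two_mul_norm {s s' : ℝ} (hs : s ∈ Icc 0 Γ.L) (hs' : s' ∈ Icc 0 Γ.L)
    (h : Γ.K * |s - s'| ≤ 1 / 2) : |s - s'| ≤ 2 * ‖Γ.γ s - Γ.γ s'‖ := by
  have h1 := Γ.norm_sub_sub_smul_tangent_le hs hs'
  have h2 : ‖(s - s') • Γ.tangent s'‖ = |s - s'| := by
    rw [norm_smul, Γ.norm_tangent hs', mul_one, Real.norm_eq_abs]
  have h3 : ‖(s - s') • Γ.tangent s'‖ ≤
      ‖Γ.γ s - Γ.γ s'‖ + ‖Γ.γ s - Γ.γ s' - (s - s') • Γ.tangent s'‖ := by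
    have := norm_sub_le (Γ.γ s - Γ.γ s') (Γ.γ s - Γ.γ s' - (s - s') • Γ.tangent s')
    simpa using this
  nlinarith [abs_nonneg (s - s')]

/-- The curve is covered by finitely many pieces that are close to their nearest points to a
given point. -/
lemma exists_centers : ∃ N : ℕ, ∀ x : Plane, ∃ c : Fin N → ℝ, ∀ s ∈ Icc 0 Γ.L,
    ∃ k, |s - c k| ≤ 4 * ‖x - Γ.γ s‖ := by
  obtain ⟨n, hn⟩ := exists_nat_gt (2 * Γ.K * Γ.L)
  have hL := Γ.L_pos
  have hn0 : (0 : ℝ) < n := lt_of_le_of_lt (by have := Γ.K_nonneg; positivity) hn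
  -- Pieces of length `L/n` satisfy `K L / n ≤ 1/2`. The additional piece catches `s = L`, where the
  -- floor below equals `n`.
  refine ⟨n + 1, fun x => ?_⟩
  let p : ℕ → Set ℝ := fun k => Icc 0 Γ.L ∩ Icc (k * (Γ.L / n)) ((k + 1) * (Γ.L / n))
  have hp : ∀ k : Fin (n + 1), ∃ c, ∀ s ∈ p k, |s - c| ≤ 4 * ‖x - Γ.γ s‖ := by
    intro k
    rcases (p k).eq_empty_or_nonempty with he | hne
    · exact ⟨0, fun s hs => by rw [he] at hs; exact hs.elim⟩
    -- With `c` the parameter in the piece nearest to `x`, the local chord-arc bound and the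
    -- triangle inequality give `|s - c| ≤ 2 ‖γ s - γ c‖ ≤ 4 ‖x - γ s‖`.
    · obtain ⟨c, hc, hmin⟩ := (isCompact_Icc.inter isCompact_Icc).exists_isMinOn hne
        (f := fun s => ‖x - Γ.γ s‖)
        ((continuousOn_const.sub (Γ.continuousOn.mono inter_subset_left)).norm)
      refine ⟨c, fun s hs => ?_⟩
      have h1 : |s - c| ≤ Γ.L / n := by
        rw [abs_le]
        constructor <;> nlinarith [hs.2.1, hs.2.2, hc.2.1, hc.2.2]
      have h2 : Γ.K * |s - c| ≤ 1 / 2 := by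
        refine (mul_le_mul_of_nonneg_left h1 Γ.K_nonneg).trans ?_
        rw [← mul_div_assoc, div_le_iff₀ hn0]
        linarith
      have h3 := Γ.abs_sub_le_two_mul_norm hs.1 hc.1 h2
      have h4 : ‖x - Γ.γ c‖ ≤ ‖x - Γ.γ s‖ := hmin hs
      have h5 : ‖Γ.γ s - Γ.γ c‖ ≤ ‖x - Γ.γ c‖ + ‖x - Γ.γ s‖ := by
        have := norm_sub_le (x - Γ.γ c) (x - Γ.γ s)
        simpa using this
      linarith
  choose c hc using hp
  refine ⟨c, fun s hs => ?_⟩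
  have hLn : 0 < Γ.L / n := by positivity
  have hq : 0 ≤ s / (Γ.L / n) := div_nonneg hs.1 hLn.le
  have hk : ⌊s / (Γ.L / n)⌋₊ < n + 1 := by
    rw [Nat.lt_succ_iff]
    refine Nat.floor_le_of_le ?_
    rw [div_le_iff₀ hLn, mul_div_cancel₀ _ hn0.ne']
    exact hs.2
  refine ⟨⟨_, hk⟩, hc ⟨_, hk⟩ s ⟨hs, ?_, ?_⟩⟩
  · rw [← le_div_iff₀ hLn]; exact Nat.floor_le hq
  · rw [← div_le_iff₀ hLn]; exact (Nat.lt_floor_add_one _).le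

/-- Gaussian integrals along the curve are at most of the order of their width. -/
lemma exists_integral_gaussian_le : ∃ C : ℝ, 0 ≤ C ∧ ∀ (x : Plane) (t : ℝ), 0 < t →
    ∫ z, Real.exp (-(1 / (2 * t)) * ‖x - z‖ ^ 2) ∂Γ.sigma ≤ C * t ^ (1 / 2 : ℝ) := by
  obtain ⟨N, hN⟩ := Γ.exists_centers
  refine ⟨N * (32 * Real.pi) ^ (1 / 2 : ℝ), by positivity, fun x t ht => ?_⟩
  obtain ⟨c, hc⟩ := hN x
  have hp := Real.pi_pos
  have hb : 0 < 1 / (32 * t) := by positivity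
  have hint : ∀ k, Integrable fun s : ℝ => Real.exp (-(1 / (32 * t)) * (s - c k) ^ 2) :=
    fun k => (integrable_exp_neg_mul_sq hb).comp_sub_right (c k)
  unfold sigma
  rw [integral_map Γ.aemeasurable (by fun_prop)]
  calc _ ≤ ∫ s in Icc 0 Γ.L, ∑ k, Real.exp (-(1 / (32 * t)) * (s - c k) ^ 2) := by
        refine integral_mono_of_nonneg (ae_of_all _ fun s => Real.exp_nonneg _)
          (integrable_finsetSum _ fun k _ => (hint k).integrableOn) ?_
        filter_upwards [ae_restrict_mem measurableSet_Icc] with s hs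
        obtain ⟨k, hk⟩ := hc s hs
        refine le_trans ?_ (Finset.single_le_sum (fun k _ => Real.exp_nonneg _) (Finset.mem_univ k))
        apply Real.exp_le_exp.2
        have h1 : (s - c k) ^ 2 ≤ 16 * ‖x - Γ.γ s‖ ^ 2 := by
          rw [← sq_abs]
          calc _ ≤ (4 * ‖x - Γ.γ s‖) ^ 2 := pow_le_pow_left₀ (abs_nonneg _) hk 2
            _ = _ := by ring
        calc -(1 / (2 * t)) * ‖x - Γ.γ s‖ ^ 2 = -(1 / (32 * t)) * (16 * ‖x - Γ.γ s‖ ^ 2) := by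
              field_simp; ring
          _ ≤ _ := by rw [neg_mul, neg_mul, neg_le_neg_iff]; gcongr
    _ = ∑ k, ∫ s in Icc 0 Γ.L, Real.exp (-(1 / (32 * t)) * (s - c k) ^ 2) :=
        integral_finsetSum _ fun k _ => (hint k).integrableOn
    _ ≤ ∑ k : Fin N, (32 * Real.pi) ^ (1 / 2 : ℝ) * t ^ (1 / 2 : ℝ) := by
        refine Finset.sum_le_sum fun k _ => ?_
        refine (setIntegral_le_integral (hint k) (ae_of_all _ fun s => Real.exp_nonneg _)).trans ?_
        rw [integral_sub_right_eq_self (fun s : ℝ => Real.exp (-(1 / (32 * t)) * s ^ 2)),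
          integral_gaussian, Real.sqrt_eq_rpow, ← Real.mul_rpow (by positivity) ht.le]
        apply le_of_eq
        congr 1
        field_simp
    _ = _ := by simp [mul_assoc]

/-- The heat kernel integrated along the curve against an `L²` density. -/
lemma exists_integral_norm_mul_heat_le {τ : Plane → ℂ} (hτ : MemLp τ 2 Γ.sigma) :
    ∃ C : ℝ, 0 ≤ C ∧ ∀ (x : Plane) (t : ℝ), 0 < t →
      ∫ z, ‖τ z‖ * heat t (x - z) ∂Γ.sigma ≤ C * t ^ (-3 / 4 : ℝ) := by
  obtain ⟨C, hC, h⟩ := Γ.exists_integral_gaussian_le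
  let D := ∫ z, ‖τ z‖ ^ 2 ∂Γ.sigma
  have hD : 0 ≤ D := integral_nonneg fun z => by positivity
  refine ⟨C + D, by positivity, fun x t ht => ?_⟩
  have hp := Real.pi_gt_three
  have hl : 0 < t ^ (3 / 4 : ℝ) := Real.rpow_pos_of_pos ht _
  have hl' : (t ^ (3 / 4 : ℝ))⁻¹ = t ^ (-3 / 4 : ℝ) := by
    rw [← Real.rpow_neg ht.le]; norm_num
  have i1 : Integrable (fun z => ‖τ z‖ ^ 2) Γ.sigma :=
    (memLp_two_iff_integrable_sq_norm hτ.aestronglyMeasurable).1 hτ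
  have i2 : Integrable (fun z => Real.exp (-(1 / (2 * t)) * ‖x - z‖ ^ 2)) Γ.sigma := by
    refine Integrable.of_bound (by fun_prop) 1 (ae_of_all _ fun z => ?_)
    rw [Real.norm_eq_abs, abs_of_nonneg (Real.exp_nonneg _), Real.exp_le_one_iff, neg_mul]
    have : 0 ≤ 1 / (2 * t) * ‖x - z‖ ^ 2 := by positivity
    linarith
  -- Weighted arithmetic-geometric mean inequality. The weight `t^{3/4}` balances the two terms: the
  -- squared kernel integrates to `O(t^{-2} t^{1/2})`, and both terms become `t^{-3/4}`.
  calc _ ≤ ∫ z, ((t ^ (3 / 4 : ℝ) * (t ^ 2)⁻¹) * Real.exp (-(1 / (2 * t)) * ‖x - z‖ ^ 2) +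
          (t ^ (3 / 4 : ℝ))⁻¹ * ‖τ z‖ ^ 2) ∂Γ.sigma := by
        refine integral_mono_of_nonneg
          (ae_of_all _ fun z => mul_nonneg (norm_nonneg _) (heat_nonneg ht.le _))
          ((i2.const_mul _).add (i1.const_mul _)) (ae_of_all _ fun z => ?_)
        have e1 : heat t (x - z) ^ 2 ≤ (t ^ 2)⁻¹ * Real.exp (-(1 / (2 * t)) * ‖x - z‖ ^ 2) := by
          rw [heat_sq, ← inv_pow]
          gcongr
          nlinarith
        have e2 : ‖τ z‖ * heat t (x - z) ≤ t ^ (3 / 4 : ℝ) * heat t (x - z) ^ 2 +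
            (t ^ (3 / 4 : ℝ))⁻¹ * ‖τ z‖ ^ 2 := by
          set l := t ^ (3 / 4 : ℝ)
          have : l * heat t (x - z) ^ 2 + l⁻¹ * ‖τ z‖ ^ 2 - 2 * (‖τ z‖ * heat t (x - z)) =
              l⁻¹ * (l * heat t (x - z) - ‖τ z‖) ^ 2 := by
            field_simp; ring
          have h3 : 0 ≤ l⁻¹ * (l * heat t (x - z) - ‖τ z‖) ^ 2 := by positivity
          have h4 := mul_nonneg (norm_nonneg (τ z)) (heat_nonneg ht.le (x - z))
          linarith
        calc _ ≤ _ := e2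
          _ ≤ _ := by
            simp only [mul_assoc (t ^ (3 / 4 : ℝ))]
            gcongr
    _ = (t ^ (3 / 4 : ℝ) * (t ^ 2)⁻¹) * ∫ z, Real.exp (-(1 / (2 * t)) * ‖x - z‖ ^ 2) ∂Γ.sigma +
          (t ^ (3 / 4 : ℝ))⁻¹ * D := by
        rw [integral_add (i2.const_mul _) (i1.const_mul _), integral_const_mul, integral_const_mul]
    _ ≤ (t ^ (3 / 4 : ℝ) * (t ^ 2)⁻¹) * (C * t ^ (1 / 2 : ℝ)) + (t ^ (3 / 4 : ℝ))⁻¹ * D := by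
        gcongr
        exact h x t ht
    _ = (C + D) * t ^ (-3 / 4 : ℝ) := by
        have : t ^ (3 / 4 : ℝ) * (t ^ 2)⁻¹ * t ^ (1 / 2 : ℝ) = t ^ (-3 / 4 : ℝ) := by
          rw [← Real.rpow_natCast, ← Real.rpow_neg ht.le, ← Real.rpow_add ht, ← Real.rpow_add ht]
          norm_num
        rw [hl']
        linear_combination C * this

end Curve

/-! ### Approximate identities and weak convergence -/

/-- The correlation of two functions. -/
def correlation (F g : Plane → ℂ) (w : Plane) : ℂ := ∫ x, F x * g (x - w)

lemma memLp_comp_sub_right {g : Plane → ℂ} (hg : MemLp g 2 volume) (w : Plane) :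
    MemLp (fun x => g (x - w)) 2 volume :=
  hg.comp_measurePreserving (measurePreserving_sub_right volume w)

/-- The correlation is an inner product with a translate of `g`, and translations act continuously
on `L²`. -/
lemma continuous_correlation {F g : Plane → ℂ} (hF : MemLp F 2 volume) (hg : MemLp g 2 volume) :
    Continuous (correlation F g) := by
  let Φ : Plane → Lp ℂ 2 (volume : Measure Plane) := fun w => DomAddAct.mk (-w) +ᵥ hg.toLp g
  have hΦ : Continuous Φ := by
    have h1 : Continuous fun w : Plane => DomAddAct.mk (-w) :=
      DomAddAct.continuous_mk.comp continuous_neg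
    have : Fact ((2 : ℝ≥0∞) ≠ ⊤) := ⟨by simp⟩
    exact h1.vadd continuous_const
  have h : correlation F g = fun w => inner ℂ ((memLp_conj hF).toLp) (Φ w) := by
    ext w
    rw [L2.inner_def]
    unfold correlation
    refine integral_congr_ae ?_
    have h2 : Φ w =ᵐ[volume] fun x => g (x - w) := by
      have h3 : Φ w = _ := DomAddAct.mk_vadd_toLp (-w) hg
      rw [h3]
      refine (MemLp.coeFn_toLp _).trans (ae_of_all _ fun x => ?_)
      simp [sub_eq_neg_add]
    filter_upwards [(memLp_conj hF).coeFn_toLp, h2] with x e1 e2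
    rw [e1, e2]
    simp [mul_comm]
  rw [h]
  exact continuous_const.inner hΦ

lemma integral_norm_mul_comp_sub_le {F g : Plane → ℂ} (hF : MemLp F 2 volume)
    (hg : MemLp g 2 volume) (w : Plane) :
    ∫ x, ‖F x * g (x - w)‖ ≤ (∫ x, ‖F x‖ ^ 2) + ∫ x, ‖g x‖ ^ 2 := by
  have i1 := (memLp_two_iff_integrable_sq_norm hF.aestronglyMeasurable).1 hF
  have i2 := (memLp_two_iff_integrable_sq_norm
    (memLp_comp_sub_right hg w).aestronglyMeasurable).1 (memLp_comp_sub_right hg w)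
  rw [← integral_sub_right_eq_self (fun x => ‖g x‖ ^ 2) w, ← integral_add i1 i2]
  refine integral_mono (integrable_mul_of_memLp hF (memLp_comp_sub_right hg w)).norm
    (i1.add i2) fun x => ?_
  simp only [norm_mul]
  nlinarith [sq_nonneg (‖F x‖ - ‖g (x - w)‖), sq_nonneg (‖F x‖ + ‖g (x - w)‖)]

lemma norm_correlation_le {F g : Plane → ℂ} (hF : MemLp F 2 volume) (hg : MemLp g 2 volume)
    (w : Plane) : ‖correlation F g w‖ ≤ (∫ x, ‖F x‖ ^ 2) + ∫ x, ‖g x‖ ^ 2 :=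
  (norm_integral_le_integral_norm _).trans (integral_norm_mul_comp_sub_le hF hg w)

/-- By Fubini, weak `L²` convergence of `k ∗ g` to `g` reduces to an approximate identity acting on
a bounded continuous function at the origin. This serves both the heat kernel and the mollifiers. -/
lemma integral_mul_convolution {F g : Plane → ℂ} (hF : MemLp F 2 volume) (hg : MemLp g 2 volume)
    {k : Plane → ℝ} (hk : Integrable k) :
    ∫ x, F x * ∫ w, (k w : ℂ) * g (x - w) = ∫ w, (k w : ℂ) * correlation F g w := by
  have hgm : AEStronglyMeasurable (fun p : Plane × Plane => g (p.1 - p.2)) (volume.prod volume) :=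
    hg.aestronglyMeasurable.comp_quasiMeasurePreserving
      (quasiMeasurePreserving_sub_of_right_invariant volume volume)
  have hkm : AEStronglyMeasurable (fun w => (k w : ℂ)) volume :=
    Complex.continuous_ofReal.comp_aestronglyMeasurable hk.aestronglyMeasurable
  have hm : AEStronglyMeasurable (fun p : Plane × Plane => F p.1 * ((k p.2 : ℂ) * g (p.1 - p.2)))
      (volume.prod volume) :=
    hF.aestronglyMeasurable.comp_fst.mul (hkm.comp_snd.mul hgm)
  have hi : Integrable (fun p : Plane × Plane => F p.1 * ((k p.2 : ℂ) * g (p.1 - p.2)))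
      (volume.prod volume) := by
    rw [integrable_prod_iff' hm]
    constructor
    · refine ae_of_all _ fun w => ?_
      have := (integrable_mul_of_memLp hF (memLp_comp_sub_right hg w)).const_mul (k w : ℂ)
      refine this.congr (ae_of_all _ fun x => ?_)
      simp only; ring
    · refine Integrable.mono' (hk.norm.mul_const ((∫ x, ‖F x‖ ^ 2) + ∫ x, ‖g x‖ ^ 2))
        hm.norm.prod_swap.integral_prod_right' (ae_of_all _ fun w => ?_)
      rw [Real.norm_eq_abs, abs_of_nonneg (integral_nonneg fun x => norm_nonneg _)]
      have : ∀ x, ‖F x * ((k w : ℂ) * g (x - w))‖ = ‖k w‖ * ‖F x * g (x - w)‖ := by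
        intro x; simp only [norm_mul, Complex.norm_real]; ring
      simp only [this]
      rw [integral_const_mul]
      exact mul_le_mul_of_nonneg_left (integral_norm_mul_comp_sub_le hF hg w) (norm_nonneg _)
  calc _ = ∫ x, ∫ w, F x * ((k w : ℂ) * g (x - w)) := by
        congr 1; ext x; rw [integral_const_mul]
    _ = ∫ w, ∫ x, F x * ((k w : ℂ) * g (x - w)) := integral_integral_swap hi
    _ = _ := by
        congr 1; ext w
        unfold correlation
        rw [← integral_const_mul]
        congr 1; ext x; ring

lemma measurable_heat_uncurry (x : Plane) :
    Measurable fun p : ℝ × Plane => heat p.1 (x - p.2) := by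
  unfold heat
  fun_prop

lemma heat_smul_sqrt {ε : ℝ} (hε : 0 < ε) (z : Plane) :
    heat ε (Real.sqrt ε • z) = ε⁻¹ * heat 1 z := by
  unfold heat
  rw [norm_smul, Real.norm_eq_abs, abs_of_nonneg (Real.sqrt_nonneg _), mul_pow,
    Real.sq_sqrt hε.le]
  have h : -(ε * ‖z‖ ^ 2) / (4 * ε) = -‖z‖ ^ 2 / (4 * 1) := by field_simp
  rw [h, mul_inv, mul_inv (4 * Real.pi) 1]
  ring

/-- The heat kernel is an approximate identity. -/
lemma tendsto_integral_heat_mul {c : Plane → ℂ} (hc : Continuous c) {B : ℝ}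
    (hB : ∀ w, ‖c w‖ ≤ B) {ε : ℕ → ℝ} (hε : ∀ n, 0 < ε n) (hε0 : Tendsto ε atTop (𝓝 0)) :
    Tendsto (fun n => ∫ w, (heat (ε n) w : ℂ) * c w) atTop (𝓝 (c 0)) := by
  have h1 : ∀ n, ∫ w, (heat (ε n) w : ℂ) * c w =
      ∫ z, (heat 1 z : ℂ) * c (Real.sqrt (ε n) • z) := by
    intro n
    -- Substitution `w = √ε z`; in the plane the Jacobian is `ε`, which cancels the factor in
    -- `heat_smul_sqrt`.
    have h := Measure.integral_comp_smul (volume : Measure Plane)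
      (fun w => (heat (ε n) w : ℂ) * c w) (Real.sqrt (ε n))
    simp only [heat_smul_sqrt (hε n), finrank_euclideanSpace_fin, Real.sq_sqrt (hε n).le] at h
    rw [abs_of_pos (inv_pos.2 (hε n))] at h
    have h2 : ∀ z : Plane, (((ε n)⁻¹ * heat 1 z : ℝ) : ℂ) * c (Real.sqrt (ε n) • z) =
        (ε n)⁻¹ • ((heat 1 z : ℂ) * c (Real.sqrt (ε n) • z)) := by
      intro z; rw [Complex.real_smul]; push_cast; ring
    simp only [h2] at h
    rw [integral_smul] at h
    exact (smul_right_injective ℂ (inv_pos.2 (hε n)).ne' h).symm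
  simp only [h1]
  have h3 : c 0 = ∫ z, (heat 1 z : ℂ) * c 0 := by
    rw [integral_mul_const, integral_complex_ofReal, integral_heat one_pos]
    simp
  rw [h3]
  have hcont := (contDiff_heat 1).continuous
  refine tendsto_integral_of_dominated_convergence (fun z => heat 1 z * B) (fun n => ?_)
    ((integrable_heat one_pos).mul_const B) (fun n => ae_of_all _ fun z => ?_)
    (ae_of_all _ fun z => ?_)
  · exact Continuous.aestronglyMeasurable (by fun_prop)
  · rw [norm_mul, Complex.norm_real, Real.norm_eq_abs, abs_of_nonneg (heat_nonneg zero_le_one z)]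
    exact mul_le_mul_of_nonneg_left (hB _) (heat_nonneg zero_le_one z)
  · refine Tendsto.const_mul _ ?_
    have h4 : Tendsto (fun n => Real.sqrt (ε n) • z) atTop (𝓝 0) := by
      have := ((Real.continuous_sqrt.tendsto 0).comp hε0).smul_const z
      simpa using this
    exact (hc.tendsto 0).comp h4

lemma heatConv_eq (ψ : Plane → ℂ) (t : ℝ) (x : Plane) :
    heatConv volume ψ t x = ∫ w, (heat t w : ℂ) * ψ (x - w) := by
  unfold heatConv
  rw [← integral_sub_left_eq_self (fun w => (heat t w : ℂ) * ψ (x - w)) volume x]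
  congr 1; ext y; rw [sub_sub_cancel, mul_comm]

lemma tendsto_integral_mul_heatConv {F ψ : Plane → ℂ} (hF : MemLp F 2 volume)
    (hψ : MemLp ψ 2 volume) {ε : ℕ → ℝ} (hε : ∀ n, 0 < ε n) (hε0 : Tendsto ε atTop (𝓝 0)) :
    Tendsto (fun n => ∫ x, F x * heatConv volume ψ (ε n) x) atTop (𝓝 (∫ x, F x * ψ x)) := by
  have h := tendsto_integral_heat_mul (continuous_correlation hF hψ)
    (norm_correlation_le hF hψ) hε hε0
  have h0 : correlation F ψ 0 = ∫ x, F x * ψ x := by simp [correlation]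
  rw [h0] at h
  refine h.congr fun n => ?_
  rw [← integral_mul_convolution hF hψ (integrable_heat (hε n))]
  simp only [heatConv_eq]

/-! ### The single layer potential and the representation of eigenfunctions -/

/-- The single layer potential of the density `τ`. -/
def layerPotential (Γ : Curve) (α κ : ℝ) (τ : Plane → ℂ) (x : Plane) : ℂ :=
  α * ∫ t in Ioi (0 : ℝ), (Real.exp (-κ ^ 2 * t) : ℂ) * heatConv Γ.sigma τ t x

section potential

variable {Γ : Curve} {α κ : ℝ} {τ : Plane → ℂ}

lemma aestronglyMeasurable_heatConv (hτ : MemLp τ 2 Γ.sigma) (x : Plane) (μ : Measure ℝ)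
    [SFinite μ] : AEStronglyMeasurable
      (fun t : ℝ => (Real.exp (-κ ^ 2 * t) : ℂ) * heatConv Γ.sigma τ t x) μ := by
  refine AEStronglyMeasurable.mul (Continuous.aestronglyMeasurable (by fun_prop)) ?_
  have h : AEStronglyMeasurable (fun p : ℝ × Plane => τ p.2 * (heat p.1 (x - p.2) : ℂ))
      (μ.prod Γ.sigma) :=
    hτ.aestronglyMeasurable.comp_snd.mul
      (Complex.measurable_ofReal.comp (measurable_heat_uncurry x)).aestronglyMeasurable
  exact h.integral_prod_right'

lemma exists_norm_heatConv_le (κ : ℝ) (hτ : MemLp τ 2 Γ.sigma) :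
    ∃ C : ℝ, ∀ (x : Plane) (t : ℝ), 0 < t →
      ‖(Real.exp (-κ ^ 2 * t) : ℂ) * heatConv Γ.sigma τ t x‖ ≤
        C * (t ^ (-3 / 4 : ℝ) * Real.exp (-κ ^ 2 * t)) := by
  obtain ⟨C, -, h⟩ := Γ.exists_integral_norm_mul_heat_le hτ
  refine ⟨C, fun x t ht => ?_⟩
  have h1 : ‖heatConv Γ.sigma τ t x‖ ≤ C * t ^ (-3 / 4 : ℝ) := by
    refine (norm_integral_le_integral_norm _).trans (le_trans (le_of_eq ?_) (h x t ht))
    congr 1; ext z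
    rw [norm_mul, Complex.norm_real, Real.norm_eq_abs, abs_of_nonneg (heat_nonneg ht.le _)]
  rw [norm_mul, Complex.norm_real, Real.norm_eq_abs, abs_of_pos (Real.exp_pos _)]
  calc _ ≤ Real.exp (-κ ^ 2 * t) * (C * t ^ (-3 / 4 : ℝ)) := by gcongr
    _ = _ := by ring

lemma integrableOn_bound (hκ : 0 < κ) (C : ℝ) :
    IntegrableOn (fun t => C * (t ^ (-3 / 4 : ℝ) * Real.exp (-κ ^ 2 * t))) (Ioi 0) := by
  have := integrableOn_rpow_mul_exp_neg_mul_rpow (p := 1) (s := -3 / 4) (b := κ ^ 2)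
    (by norm_num) one_pos (by positivity)
  simp only [Real.rpow_one] at this
  exact this.const_mul C

lemma integrableOn_heatConv (hκ : 0 < κ) (hτ : MemLp τ 2 Γ.sigma) (x : Plane) :
    IntegrableOn (fun t : ℝ => (Real.exp (-κ ^ 2 * t) : ℂ) * heatConv Γ.sigma τ t x) (Ioi 0) := by
  obtain ⟨C, hC⟩ := exists_norm_heatConv_le κ hτ
  refine Integrable.mono' (integrableOn_bound hκ C) (aestronglyMeasurable_heatConv hτ x _) ?_
  filter_upwards [ae_restrict_mem measurableSet_Ioi] with t ht using hC x t ht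

lemma continuous_heatConv (hτ : MemLp τ 2 Γ.sigma) {t : ℝ} (ht : 0 < t) :
    Continuous fun x => heatConv Γ.sigma τ t x := by
  have hc := (contDiff_heat t).continuous
  refine continuous_of_dominated (bound := fun z => ‖τ z‖ * (4 * Real.pi * t)⁻¹) (fun x => ?_)
    (fun x => ae_of_all _ fun z => ?_) ((hτ.integrable (by norm_num)).norm.mul_const _)
    (ae_of_all _ fun z => by fun_prop)
  · exact hτ.aestronglyMeasurable.mul (Continuous.aestronglyMeasurable (by fun_prop))
  · rw [norm_mul, Complex.norm_real, Real.norm_eq_abs, abs_of_nonneg (heat_nonneg ht.le _), heat_eq]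
    have hp := Real.pi_pos
    refine mul_le_mul_of_nonneg_left (mul_le_of_le_one_right (by positivity) ?_) (norm_nonneg _)
    rw [Real.exp_le_one_iff, neg_mul]
    have : 0 ≤ 1 / (4 * t) * ‖x - z‖ ^ 2 := by positivity
    linarith

lemma continuous_layerPotential (hκ : 0 < κ) (hτ : MemLp τ 2 Γ.sigma) :
    Continuous (layerPotential Γ α κ τ) := by
  obtain ⟨C, hC⟩ := exists_norm_heatConv_le κ hτ
  refine continuous_const.mul (continuous_of_dominated
    (fun x => aestronglyMeasurable_heatConv hτ x _) (fun x => ?_) (integrableOn_bound hκ C) ?_)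
  · filter_upwards [ae_restrict_mem measurableSet_Ioi] with t ht using hC x t ht
  · filter_upwards [ae_restrict_mem measurableSet_Ioi] with t ht
    exact continuous_const.mul (continuous_heatConv hτ ht)

/-- A single `B` for all points and all sets of times: it bounds the potential itself, and it
dominates the truncated potentials in the limit `ε → 0`. -/
lemma exists_norm_integral_heatConv_le (hκ : 0 < κ) (hτ : MemLp τ 2 Γ.sigma) :
    ∃ B : ℝ, ∀ (x : Plane) (s : Set ℝ), MeasurableSet s → s ⊆ Ioi 0 →
      ‖(α : ℂ) * ∫ t in s, (Real.exp (-κ ^ 2 * t) : ℂ) * heatConv Γ.sigma τ t x‖ ≤ B := by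
  obtain ⟨C, hC⟩ := exists_norm_heatConv_le κ hτ
  refine ⟨|α| * ∫ t in Ioi (0 : ℝ), |C * (t ^ (-3 / 4 : ℝ) * Real.exp (-κ ^ 2 * t))|,
    fun x s hs hsub => ?_⟩
  rw [norm_mul, Complex.norm_real, Real.norm_eq_abs]
  refine mul_le_mul_of_nonneg_left ?_ (abs_nonneg _)
  have hi : IntegrableOn (fun t => |C * (t ^ (-3 / 4 : ℝ) * Real.exp (-κ ^ 2 * t))|) (Ioi 0) :=
    (integrableOn_bound hκ C).abs
  refine (norm_integral_le_of_norm_le (hi.mono_set hsub) ?_).trans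
    (setIntegral_mono_set hi (ae_of_all _ fun t => abs_nonneg _) hsub.eventuallyLE)
  filter_upwards [ae_restrict_mem hs] with t ht
  exact (hC x t (hsub ht)).trans (le_abs_self _)

end potential

namespace WeakSolution

variable {Γ : Curve} {α κ : ℝ} {ψ : Plane → ℂ} {G : Plane → EuclideanSpace ℂ (Fin 2)}
  {τ : Plane → ℂ}

lemma tendsto_exp_mul_heatConv (h : WeakSolution Γ α κ ψ G τ) (hκ : 0 < κ) (x : Plane) :
    Tendsto (fun t : ℝ => (Real.exp (-κ ^ 2 * t) : ℂ) * heatConv volume ψ t x) atTop (𝓝 0) := by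
  have h1 : Tendsto (fun t : ℝ => Real.exp (-κ ^ 2 * t) * ((∫ y, ‖ψ y‖ ^ 2) + 1)) atTop
      (𝓝 (0 * ((∫ y, ‖ψ y‖ ^ 2) + 1))) := by
    refine Tendsto.mul_const _ (Real.tendsto_exp_atBot.comp ?_)
    exact tendsto_id.const_mul_atTop_of_neg (by simpa using by positivity)
  rw [zero_mul] at h1
  refine squeeze_zero_norm' ?_ h1
  filter_upwards [eventually_ge_atTop 1] with t ht
  rw [norm_mul, Complex.norm_real, Real.norm_eq_abs, abs_of_pos (Real.exp_pos _)]
  exact mul_le_mul_of_nonneg_left (norm_heatConv_le h.sobolev.memLp ht x) (Real.exp_pos _).le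

/-- The heat flow of a solution is a truncated layer potential. -/
lemma exp_mul_heatConv_eq (h : WeakSolution Γ α κ ψ G τ) (hκ : 0 < κ) {ε : ℝ} (hε : 0 < ε)
    (x : Plane) : (Real.exp (-κ ^ 2 * ε) : ℂ) * heatConv volume ψ ε x =
      α * ∫ t in Ioi ε, (Real.exp (-κ ^ 2 * t) : ℂ) * heatConv Γ.sigma τ t x := by
  have hi : IntegrableOn (fun t : ℝ =>
      -((α : ℂ) * ((Real.exp (-κ ^ 2 * t) : ℂ) * heatConv Γ.sigma τ t x))) (Ioi ε) :=
    (((integrableOn_heatConv hκ h.sobolev.trace.1 x).mono_set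
      (Ioi_subset_Ioi hε.le)).const_mul (α : ℂ)).neg
  have key := integral_Ioi_of_hasDerivAt_of_tendsto'
    (fun t ht => h.hasDerivAt_exp_mul_heatConv (lt_of_lt_of_le hε ht) x) hi
    (h.tendsto_exp_mul_heatConv hκ x)
  rw [integral_neg, integral_const_mul] at key
  linear_combination key

/-- The truncated time integrals converge to the full one, and the factor `e^{κ²ε}` that isolates
the heat flow tends to `1`. -/
lemma tendsto_heatConv (h : WeakSolution Γ α κ ψ G τ) (hκ : 0 < κ) (x : Plane) :
    Tendsto (fun n : ℕ => heatConv volume ψ (1 / ((n : ℝ) + 1)) x) atTop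
      (𝓝 (layerPotential Γ α κ τ x)) := by
  have hε : ∀ n : ℕ, (0 : ℝ) < 1 / ((n : ℝ) + 1) := fun n => Nat.one_div_pos_of_nat
  have hU : ⋃ n : ℕ, Ioi (1 / ((n : ℝ) + 1)) = Ioi (0 : ℝ) := by
    ext t
    simp only [mem_iUnion, mem_Ioi]
    exact ⟨fun ⟨n, hn⟩ => (hε n).trans hn, fun ht => exists_nat_one_div_lt ht⟩
  have h1 := tendsto_setIntegral_of_monotone (μ := volume)
    (s := fun n : ℕ => Ioi (1 / ((n : ℝ) + 1)))
    (f := fun t : ℝ => (Real.exp (-κ ^ 2 * t) : ℂ) * heatConv Γ.sigma τ t x)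
    (fun n => measurableSet_Ioi) (fun m n hmn => Ioi_subset_Ioi (Nat.one_div_le_one_div hmn))
    (by rw [hU]; exact integrableOn_heatConv hκ h.sobolev.trace.1 x)
  rw [hU] at h1
  have h2 : Tendsto (fun n : ℕ => ((Real.exp (κ ^ 2 * (1 / ((n : ℝ) + 1))) : ℝ) : ℂ)) atTop
      (𝓝 1) := by
    have h3 : Tendsto (fun n : ℕ => Real.exp (κ ^ 2 * (1 / ((n : ℝ) + 1)))) atTop
        (𝓝 (Real.exp (κ ^ 2 * 0))) :=
      (Real.continuous_exp.tendsto _).comp (tendsto_one_div_add_atTop_nhds_zero_nat.const_mul _)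
    rw [mul_zero, Real.exp_zero] at h3
    exact_mod_cast (Complex.continuous_ofReal.tendsto _).comp h3
  have h4 := h2.mul (h1.const_mul (α : ℂ))
  rw [one_mul] at h4
  refine h4.congr fun n => ?_
  rw [← h.exp_mul_heatConv_eq hκ (hε n) x, ← mul_assoc, ← Complex.ofReal_mul, ← Real.exp_add]
  simp

/-- As `ε → 0` the heat flow of `ψ` converges weakly to `ψ`, and pointwise and boundedly to the
potential. Tested against a bump, both limits agree. -/
lemma ae_eq_layerPotential (h : WeakSolution Γ α κ ψ G τ) (hκ : 0 < κ) :
    ψ =ᵐ[volume] layerPotential Γ α κ τ := by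
  have hε : ∀ n : ℕ, (0 : ℝ) < 1 / ((n : ℝ) + 1) := fun n => Nat.one_div_pos_of_nat
  have hc : Continuous (layerPotential Γ α κ τ) := continuous_layerPotential hκ h.sobolev.trace.1
  obtain ⟨B, hB⟩ := exists_norm_integral_heatConv_le (α := α) hκ h.sobolev.trace.1
  refine ae_eq_of_integral_contDiff_smul_eq (h.sobolev.memLp.locallyIntegrable one_le_two)
    hc.locallyIntegrable fun g hg hgc => ?_
  have hg' : ContDiff ℝ ∞ fun x => (g x : ℂ) := Complex.ofRealCLM.contDiff.comp hg
  have hgc' : HasCompactSupport fun x => (g x : ℂ) :=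
    hgc.comp_left (g := fun r : ℝ => (r : ℂ)) rfl
  have h1 := tendsto_integral_mul_heatConv (memLp_of_test hg' hgc' volume 2) h.sobolev.memLp hε
    tendsto_one_div_add_atTop_nhds_zero_nat
  have h2 : Tendsto (fun n : ℕ => ∫ x, (g x : ℂ) * heatConv volume ψ (1 / ((n : ℝ) + 1)) x) atTop
      (𝓝 (∫ x, (g x : ℂ) * layerPotential Γ α κ τ x)) := by
    have heq : ∀ n : ℕ, ∀ x, heatConv volume ψ (1 / ((n : ℝ) + 1)) x =
        (Real.exp (κ ^ 2 * (1 / ((n : ℝ) + 1))) : ℂ) * (α * ∫ t in Ioi (1 / ((n : ℝ) + 1)),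
          (Real.exp (-κ ^ 2 * t) : ℂ) * heatConv Γ.sigma τ t x) := by
      intro n x
      rw [← h.exp_mul_heatConv_eq hκ (hε n) x, ← mul_assoc, ← Complex.ofReal_mul, ← Real.exp_add]
      simp
    refine tendsto_integral_of_dominated_convergence
      (fun x => ‖(g x : ℂ)‖ * (Real.exp (κ ^ 2) * B)) (fun n => ?_) ?_
      (fun n => ae_of_all _ fun x => ?_)
      (ae_of_all _ fun x => (h.tendsto_heatConv hκ x).const_mul _)
    · refine hg'.continuous.aestronglyMeasurable.mul ?_
      have hm : AEStronglyMeasurable (fun p : Plane × Plane =>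
          ψ p.2 * (heat (1 / ((n : ℝ) + 1)) (p.1 - p.2) : ℂ)) (volume.prod volume) := by
        have := (contDiff_heat (1 / ((n : ℝ) + 1))).continuous
        exact h.sobolev.memLp.aestronglyMeasurable.comp_snd.mul
          (Continuous.aestronglyMeasurable (by fun_prop))
      exact hm.integral_prod_right'
    · exact (hg'.continuous.integrable_of_hasCompactSupport hgc').norm.mul_const _
    · rw [norm_mul, heq, norm_mul]
      refine mul_le_mul_of_nonneg_left (mul_le_mul ?_
        (hB x _ measurableSet_Ioi (Ioi_subset_Ioi (hε n).le)) (norm_nonneg _)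
        (Real.exp_pos _).le) (norm_nonneg _)
      rw [Complex.norm_real, Real.norm_eq_abs, abs_of_pos (Real.exp_pos _)]
      apply Real.exp_le_exp.2
      refine mul_le_of_le_one_right (by positivity) ?_
      rw [div_le_one (by positivity)]
      have : (0 : ℝ) ≤ n := n.cast_nonneg
      linarith
  have h3 := tendsto_nhds_unique h1 h2
  simpa only [Complex.real_smul] using h3

end WeakSolution

/-! ### Mollification and the bound for the trace -/

open scoped Convolution

lemma tendsto_integral_mul_of_eLpNorm {μ : Measure Plane} {F g : Plane → ℂ} {f : ℕ → Plane → ℂ}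
    (hF : MemLp F 2 μ) (hg : MemLp g 2 μ) (hf : ∀ n, MemLp (f n) 2 μ)
    (h : Tendsto (fun n => eLpNorm (f n - g) 2 μ) atTop (𝓝 0)) :
    Tendsto (fun n => ∫ x, F x * f n x ∂μ) atTop (𝓝 (∫ x, F x * g x ∂μ)) := by
  refine tendsto_integral_of_L1' _ (integrable_mul_of_memLp hF hg).aestronglyMeasurable
    (Eventually.of_forall fun n => integrable_mul_of_memLp hF (hf n)) ?_
  have h1 : Tendsto (fun n => eLpNorm F 2 μ * eLpNorm (f n - g) 2 μ) atTop (𝓝 0) := by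
    have := ENNReal.Tendsto.const_mul h (Or.inr hF.2.ne)
    simpa using this
  refine tendsto_of_tendsto_of_tendsto_of_le_of_le tendsto_const_nhds h1 (fun n => zero_le)
    fun n => ?_
  have h2 := eLpNorm_smul_le_mul_eLpNorm (p := 2) (q := 2) (r := 1)
    ((hf n).sub hg).aestronglyMeasurable hF.aestronglyMeasurable
  refine le_trans (le_of_eq ?_) h2
  congr 1
  ext x
  simp [mul_sub]

lemma memLp_mul_of_test {F χ : Plane → ℂ} (hF : MemLp F 2 volume) (hχ : Continuous χ)
    (hχc : HasCompactSupport χ) : MemLp (fun x => F x * χ x) 2 volume := by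
  obtain ⟨C, hC⟩ := hχ.bounded_above_of_compact_support hχc
  refine hF.of_le_mul (c := C) (hF.aestronglyMeasurable.mul hχ.aestronglyMeasurable)
    (ae_of_all _ fun x => ?_)
  rw [norm_mul, mul_comm]
  exact mul_le_mul_of_nonneg_right (hC x) (norm_nonneg _)

namespace WeakSolution

variable {Γ : Curve} {α κ : ℝ} {ψ : Plane → ℂ} {G : Plane → EuclideanSpace ℂ (Fin 2)}
  {τ : Plane → ℂ}

/-- If smooth functions and their gradients converge weakly to `conj ψ` and its gradient, the
localized integrals of the functions against the trace have a limit determined by `ψ`. -/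
lemma tendsto_integral_trace_mul (h : WeakSolution Γ α κ ψ G τ) {f : ℕ → Plane → ℂ}
    (hf : ∀ n, ContDiff ℝ ∞ (f n))
    (h1 : ∀ F : Plane → ℂ, MemLp F 2 volume →
      Tendsto (fun n => ∫ x, F x * f n x) atTop (𝓝 (∫ x, F x * (starRingEnd ℂ) (ψ x))))
    (h2 : ∀ (F : Plane → ℂ) (i : Fin 2), MemLp F 2 volume →
      Tendsto (fun n => ∫ x, F x * grad (f n) x i) atTop
        (𝓝 (∫ x, F x * (starRingEnd ℂ) (G x i))))
    {χ : Plane → ℂ} (hχ : ContDiff ℝ ∞ χ) (hχc : HasCompactSupport χ) :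
    Tendsto (fun n => (α : ℂ) * ∫ x, τ x * (χ x * f n x) ∂Γ.sigma) atTop
      (𝓝 ((∑ i, ((∫ x, G x i * χ x * (starRingEnd ℂ) (G x i)) +
        ∫ x, G x i * grad χ x i * (starRingEnd ℂ) (ψ x))) +
        (κ : ℂ) ^ 2 * ∫ x, ψ x * χ x * (starRingEnd ℂ) (ψ x))) := by
  have hG := fun i => memLp_component h.sobolev.memLp_grad i
  have hχg := fun i => continuous_grad_apply hχ i
  have hχgc := fun i => hasCompactSupport_grad_apply hχc i
  -- Testing with `χ * f n` and the product rule express the trace integral by volume integrals, in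
  -- which weak `L²` convergence is enough.
  refine ((tendsto_finsetSum Finset.univ fun i _ =>
    (h2 _ i (memLp_mul_of_test (hG i) hχ.continuous hχc)).add
    (h1 _ (memLp_mul_of_test (hG i) (hχg i) (hχgc i)))).add
    ((h1 _ (memLp_mul_of_test h.sobolev.memLp hχ.continuous hχc)).const_mul _)).congr fun n => ?_
  rw [← h.weak _ (hχ.mul (hf n)) hχc.mul_right]
  congr 1
  · refine Finset.sum_congr rfl fun i _ => ?_
    rw [← integral_add]
    · congr 1; ext x
      rw [grad_mul_apply (hχ.differentiable (by simp) x) ((hf n).differentiable (by simp) x)]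
      ring
    · have h3 : MemLp (fun x => χ x * grad (f n) x i) 2 volume :=
        (hχ.continuous.mul (continuous_grad_apply (hf n) i)).memLp_of_hasCompactSupport
          hχc.mul_right
      refine (integrable_mul_of_memLp (hG i) h3).congr (ae_of_all _ fun x => ?_)
      simp only; ring
    · have h3 : MemLp (fun x => grad χ x i * f n x) 2 volume :=
        ((hχg i).mul (hf n).continuous).memLp_of_hasCompactSupport (hχgc i).mul_right
      refine (integrable_mul_of_memLp (hG i) h3).congr (ae_of_all _ fun x => ?_)
      simp only; ring
  · congr 2; ext x; ring

lemma weakGradient_conj (h : WeakSolution Γ α κ ψ G τ) {φ : Plane → ℂ} (hφ : ContDiff ℝ ∞ φ)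
    (hc : HasCompactSupport φ) (i : Fin 2) :
    ∫ x, (starRingEnd ℂ) (ψ x) * grad φ x i = - ∫ x, (starRingEnd ℂ) (G x i) * φ x := by
  have h1 := h.sobolev.weakGradient _ (contDiff_conj hφ) (hasCompactSupport_conj hc) i
  simp only [grad_conj_apply] at h1
  have h2 := congrArg (starRingEnd ℂ) h1
  rw [map_neg, ← integral_conj, ← integral_conj] at h2
  simpa using h2

end WeakSolution

/-- A shrinking sequence of bump functions. -/
def shrinkingBump (n : ℕ) : ContDiffBump (0 : Plane) :=
  ⟨1 / (2 * ((n : ℝ) + 1)), 1 / ((n : ℝ) + 1), by positivity, by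
    apply one_div_lt_one_div_of_lt (by positivity)
    have : (0 : ℝ) ≤ n := n.cast_nonneg
    linarith⟩

/-- The mollification of `g`. -/
def mollify (n : ℕ) (g : Plane → ℂ) : Plane → ℂ :=
  (shrinkingBump n).normed volume ⋆[ContinuousLinearMap.lsmul ℝ ℝ, volume] g

lemma tendsto_shrinkingBump : Tendsto (fun n => (shrinkingBump n).rOut) atTop (𝓝 0) :=
  tendsto_one_div_add_atTop_nhds_zero_nat

lemma mollify_apply (n : ℕ) (g : Plane → ℂ) (x : Plane) :
    mollify n g x = ∫ w, (((shrinkingBump n).normed volume w : ℝ) : ℂ) * g (x - w) := by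
  simp [mollify, convolution, Complex.real_smul]

lemma contDiff_mollify (n : ℕ) {g : Plane → ℂ} (hg : MemLp g 2 volume) :
    ContDiff ℝ ∞ (mollify n g) :=
  (shrinkingBump n).hasCompactSupport_normed.contDiff_convolution_left _
    (shrinkingBump n).contDiff_normed (hg.locallyIntegrable one_le_two)

lemma mollify_congr (n : ℕ) {g g' : Plane → ℂ} (h : g =ᵐ[volume] g') :
    mollify n g = mollify n g' := by
  ext x
  rw [mollify_apply, mollify_apply]
  refine integral_congr_ae ?_
  filter_upwards [(quasiMeasurePreserving_sub_left_of_right_invariant volume x).ae_eq_comp h]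
    with w hw
  simp only [Function.comp_apply] at hw
  rw [hw]

lemma tendsto_integral_mul_mollify {F g : Plane → ℂ} (hF : MemLp F 2 volume)
    (hg : MemLp g 2 volume) :
    Tendsto (fun n => ∫ x, F x * mollify n g x) atTop (𝓝 (∫ x, F x * g x)) := by
  have hc := continuous_correlation hF hg
  -- The reflection compensates the argument `0 - w` in the convolution at the origin.
  have h := ContDiffBump.convolution_tendsto_right_of_continuous (μ := volume)
    tendsto_shrinkingBump (hc.comp continuous_neg) 0
  have h0 : (correlation F g ∘ Neg.neg) 0 = ∫ x, F x * g x := by simp [correlation]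
  rw [h0] at h
  refine h.congr fun n => ?_
  simp only [mollify_apply]
  rw [integral_mul_convolution hF hg (shrinkingBump n).integrable_normed]
  simp [convolution, Complex.real_smul]

lemma tendsto_mollify {g : Plane → ℂ} (hg : Continuous g) (x : Plane) :
    Tendsto (fun n => mollify n g x) atTop (𝓝 (g x)) :=
  ContDiffBump.convolution_tendsto_right_of_continuous tendsto_shrinkingBump hg x

lemma norm_mollify_le (n : ℕ) {g : Plane → ℂ} {B : ℝ} (h : ∀ x, ‖g x‖ ≤ B) (x : Plane) :
    ‖mollify n g x‖ ≤ B := by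
  rw [mollify_apply]
  have hi := (shrinkingBump n).integrable_normed (μ := (volume : Measure Plane))
  refine (norm_integral_le_of_norm_le (hi.mul_const B) (ae_of_all _ fun w => ?_)).trans
    (le_of_eq ?_)
  · rw [norm_mul, Complex.norm_real, Real.norm_eq_abs,
      abs_of_nonneg ((shrinkingBump n).nonneg_normed w)]
    exact mul_le_mul_of_nonneg_left (h _) ((shrinkingBump n).nonneg_normed w)
  · rw [integral_mul_const, (shrinkingBump n).integral_normed, one_mul]

/-- Mollification commutes with weak derivatives. -/
lemma grad_mollify (n : ℕ) {g g' : Plane → ℂ} (hg : MemLp g 2 volume) (i : Fin 2)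
    (h : ∀ φ : Plane → ℂ, ContDiff ℝ ∞ φ → HasCompactSupport φ →
      ∫ x, g x * grad φ x i = - ∫ x, g' x * φ x) (x : Plane) :
    grad (mollify n g) x i = mollify n g' x := by
  let ρ : Plane → ℝ := (shrinkingBump n).normed volume
  have hρ : ContDiff ℝ ∞ ρ := (shrinkingBump n).contDiff_normed
  have hρc : HasCompactSupport ρ := (shrinkingBump n).hasCompactSupport_normed
  have hgl : LocallyIntegrable g volume := hg.locallyIntegrable one_le_two
  have hd : HasFDerivAt (mollify n g) _ x := hρc.hasFDerivAt_convolution_left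
    (ContinuousLinearMap.lsmul ℝ ℝ : ℝ →L[ℝ] ℂ →L[ℝ] ℂ) (hρ.of_le (by simp)) hgl x
  rw [grad_apply, hd.fderiv]
  have hex := (hρc.fderiv (𝕜 := ℝ)).convolutionExists_left
    ((ContinuousLinearMap.lsmul ℝ ℝ : ℝ →L[ℝ] ℂ →L[ℝ] ℂ).precompL Plane)
    (hρ.continuous_fderiv (by simp)) hgl x
  rw [convolution, ContinuousLinearMap.integral_apply hex]
  -- The reflected and translated mollifier as test function. Its derivative changes sign, which
  -- cancels the sign in the weak derivative.
  let φ : Plane → ℂ := fun y => (ρ (x - y) : ℂ)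
  have hφ : ContDiff ℝ ∞ φ :=
    Complex.ofRealCLM.contDiff.comp (hρ.comp (contDiff_const.sub contDiff_id))
  have hφc : HasCompactSupport φ :=
    (hρc.comp_homeomorph (Homeomorph.subLeft x)).comp_left (g := fun r : ℝ => (r : ℂ)) rfl
  have hφg : ∀ y, grad φ y i = -((fderiv ℝ ρ (x - y) (EuclideanSpace.single i 1) : ℝ) : ℂ) := by
    intro y
    have h1 : HasFDerivAt (fun y => ρ (x - y)) ((fderiv ℝ ρ (x - y)).comp
        (-ContinuousLinearMap.id ℝ Plane)) y :=
      ((hρ.differentiable (by simp) _).hasFDerivAt).comp y ((hasFDerivAt_id y).const_sub x)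
    rw [grad_ofReal h1]
    simp
  have key := h φ hφ hφc
  simp only [hφg, mul_neg, integral_neg, neg_inj] at key
  rw [mollify_apply, ← integral_sub_left_eq_self _ volume x, ← integral_sub_left_eq_self
    (fun w => (((shrinkingBump n).normed volume w : ℝ) : ℂ) * g' (x - w)) volume x]
  refine Eq.trans ?_ (key.trans ?_)
  · congr 1; ext y
    simp [Complex.real_smul, mul_comm]
  · congr 1; ext y
    simp [φ, ρ, mul_comm]

namespace WeakSolution

variable {Γ : Curve} {α κ : ℝ} {ψ : Plane → ℂ} {G : Plane → EuclideanSpace ℂ (Fin 2)}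
  {τ : Plane → ℂ}

/-- The trace is only given as an `L²(σ_Γ)` limit, whereas `ψ` is known up to null sets of the
plane, and the curve is such a set. The equation itself links them: integrals of `τ` against
approximations of `conj ψ` depend in the limit on `ψ` and `G` only. -/
lemma norm_trace_le (h : WeakSolution Γ α κ ψ G τ) (hα : 0 < α) (hκ : 0 < κ) :
    ∀ᵐ x ∂Γ.sigma, ‖τ x‖ ≤ ‖layerPotential Γ α κ τ x‖ := by
  set u := layerPotential Γ α κ τ with hu_def
  have hτ := h.sobolev.trace.1
  have hψ := h.sobolev.memLp
  have hG := fun i => memLp_component h.sobolev.memLp_grad i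
  have hu : Continuous u := continuous_layerPotential hκ hτ
  obtain ⟨B, hB⟩ := exists_norm_integral_heatConv_le (α := α) hκ hτ
  have hB' : ∀ x, ‖u x‖ ≤ B := fun x => hB x _ measurableSet_Ioi Subset.rfl
  have huc : Continuous fun x => (starRingEnd ℂ) (u x) := Complex.continuous_conj.comp hu
  -- Two approximations of `conj ψ` are compared: the one that defines the trace tends to `conj τ`
  -- in `L²(σ_Γ)`, and the mollifications tend to `conj u` at every point of the plane.
  have hlim : ∀ χ : Plane → ℂ, ContDiff ℝ ∞ χ → HasCompactSupport χ →
      ∫ x, τ x * (χ x * (starRingEnd ℂ) (τ x)) ∂Γ.sigma =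
        ∫ x, τ x * (χ x * (starRingEnd ℂ) (u x)) ∂Γ.sigma := by
    intro χ hχ hχc
    obtain ⟨C, hC⟩ := hχ.continuous.bounded_above_of_compact_support hχc
    obtain ⟨φ, hφ, hφ1, hφ2, hφ3⟩ := h.sobolev.trace.2
    have hconj : ∀ {μ : Measure Plane} (v w : Plane → ℂ),
        eLpNorm ((fun x => (starRingEnd ℂ) (v x)) - fun x => (starRingEnd ℂ) (w x)) 2 μ =
          eLpNorm (v - w) 2 μ := by
      intro μ v w
      refine eLpNorm_congr_norm_ae (ae_of_all _ fun x => ?_)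
      simp only [Pi.sub_apply, ← map_sub, RCLike.norm_conj]
    have l1 := h.tendsto_integral_trace_mul (f := fun n x => (starRingEnd ℂ) (φ n x))
      (fun n => contDiff_conj (hφ n).1) (fun F hF => ?_) (fun F i hF => ?_) hχ hχc
    have l2 := h.tendsto_integral_trace_mul
      (f := fun n => mollify n fun x => (starRingEnd ℂ) (ψ x))
      (fun n => contDiff_mollify n (memLp_conj hψ))
      (fun F hF => tendsto_integral_mul_mollify hF (memLp_conj hψ)) (fun F i hF => ?_) hχ hχc
    have l3 : Tendsto (fun n => ∫ x, τ x * (χ x * (starRingEnd ℂ) (φ n x)) ∂Γ.sigma) atTop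
        (𝓝 (∫ x, τ x * (χ x * (starRingEnd ℂ) (τ x)) ∂Γ.sigma)) := by
      have hτχ : MemLp (fun x => τ x * χ x) 2 Γ.sigma := by
        refine hτ.of_le_mul (c := C) (hτ.aestronglyMeasurable.mul
          hχ.continuous.aestronglyMeasurable) (ae_of_all _ fun x => ?_)
        rw [norm_mul, mul_comm]
        exact mul_le_mul_of_nonneg_right (hC x) (norm_nonneg _)
      have := tendsto_integral_mul_of_eLpNorm hτχ (memLp_conj hτ)
        (f := fun n x => (starRingEnd ℂ) (φ n x))
        (fun n => Γ.memLp_of_continuous (contDiff_conj (hφ n).1).continuous)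
        (by simpa only [hconj] using hφ3)
      simpa only [mul_assoc] using this
    have l4 : Tendsto (fun n => ∫ x, τ x * (χ x * mollify n (fun x => (starRingEnd ℂ) (ψ x)) x)
        ∂Γ.sigma) atTop (𝓝 (∫ x, τ x * (χ x * (starRingEnd ℂ) (u x)) ∂Γ.sigma)) := by
      -- Mollification does not see null sets of the plane, so `ψ` may be replaced by the bounded
      -- continuous `u`; convergence then holds everywhere, in particular on the curve.
      have hae : (fun x => (starRingEnd ℂ) (ψ x)) =ᵐ[volume] fun x => (starRingEnd ℂ) (u x) := by
        filter_upwards [h.ae_eq_layerPotential hκ] with x hx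
        rw [hx]
      have hm := fun n => (contDiff_mollify n (memLp_conj hψ)).continuous
      refine tendsto_integral_of_dominated_convergence (fun x => ‖τ x‖ * (C * B)) (fun n => ?_)
        ((hτ.integrable one_le_two).norm.mul_const _) (fun n => ae_of_all _ fun x => ?_)
        (ae_of_all _ fun x => ?_)
      · exact hτ.aestronglyMeasurable.mul (hχ.continuous.mul (hm n)).aestronglyMeasurable
      · rw [norm_mul, norm_mul, mollify_congr n hae]
        refine mul_le_mul_of_nonneg_left (mul_le_mul (hC x) ?_ (norm_nonneg _)
          ((norm_nonneg _).trans (hC x))) (norm_nonneg _)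
        exact norm_mollify_le n (fun x => by simpa using hB' x) x
      · simp only [fun n => mollify_congr n hae]
        exact ((tendsto_mollify huc x).const_mul _).const_mul _
    · have e1 := tendsto_nhds_unique l1 (l3.const_mul (α : ℂ))
      have e2 := tendsto_nhds_unique l2 (l4.const_mul (α : ℂ))
      exact mul_left_cancel₀ (Complex.ofReal_ne_zero.2 hα.ne') (e1.symm.trans e2)
    · simp only [fun n x => grad_mollify n (memLp_conj hψ) i
        (fun φ hφ hc => h.weakGradient_conj hφ hc i) x]
      exact tendsto_integral_mul_mollify hF (memLp_conj (hG i))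
    · exact tendsto_integral_mul_of_eLpNorm hF (memLp_conj hψ)
        (fun n => memLp_conj (memLp_of_test (hφ n).1 (hφ n).2 _ _))
        (by simpa only [hconj] using hφ1)
    · simp only [grad_conj_apply]
      refine tendsto_integral_mul_of_eLpNorm hF (memLp_conj (hG i))
        (f := fun n x => (starRingEnd ℂ) (grad (φ n) x i))
        (fun n => memLp_conj (memLp_component (memLp_grad_of_test (hφ n).1 (hφ n).2) i)) ?_
      simp only [hconj]
      refine tendsto_of_tendsto_of_tendsto_of_le_of_le tendsto_const_nhds hφ2
        (fun n => zero_le) fun n => eLpNorm_mono fun x => ?_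
      exact PiLp.norm_apply_le ((grad (φ n) - G) x) i
  have huL : MemLp u 2 Γ.sigma := Γ.memLp_of_continuous hu
  -- The comparison yields `τ = u` only where `τ ≠ 0`. This is enough for the asserted inequality.
  have hzero : ∀ᵐ x ∂Γ.sigma, τ x * (starRingEnd ℂ) (τ x - u x) = 0 := by
    refine ae_eq_zero_of_integral_contDiff_smul_eq_zero
      (integrable_mul_of_memLp hτ (memLp_conj (hτ.sub huL))).locallyIntegrable fun g hg hgc => ?_
    have hg' : ContDiff ℝ ∞ fun x => (g x : ℂ) := Complex.ofRealCLM.contDiff.comp hg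
    have hgc' : HasCompactSupport fun x => (g x : ℂ) :=
      hgc.comp_left (g := fun r : ℝ => (r : ℂ)) rfl
    have hb : ∀ v : Plane → ℂ, MemLp v 2 Γ.sigma →
        Integrable (fun x => τ x * ((g x : ℂ) * (starRingEnd ℂ) (v x))) Γ.sigma := by
      intro v hv
      obtain ⟨C, hC⟩ := hg'.continuous.bounded_above_of_compact_support hgc'
      refine integrable_mul_of_memLp hτ ((memLp_conj hv).of_le_mul (c := C)
        (hg'.continuous.aestronglyMeasurable.mul (memLp_conj hv).aestronglyMeasurable)
        (ae_of_all _ fun x => ?_))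
      rw [norm_mul]
      exact mul_le_mul_of_nonneg_right (hC x) (norm_nonneg _)
    have := sub_eq_zero.2 (hlim _ hg' hgc')
    rw [← integral_sub (hb _ hτ) (hb _ huL)] at this
    rw [← this]
    congr 1; ext x
    rw [Complex.real_smul, map_sub]; ring
  filter_upwards [hzero] with x hx
  rcases mul_eq_zero.1 hx with h0 | h0
  · rw [h0, norm_zero]; exact norm_nonneg _
  · rw [map_eq_zero, sub_eq_zero] at h0
    rw [h0]

end WeakSolution

/-! ### The gradient of the layer potential -/

/-- The time integral of the norm of the gradient of the heat kernel. -/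
lemma integral_heat_gradient {z : Plane} (hz : z ≠ 0) :
    IntegrableOn (fun t => ‖z‖ / (2 * t) * heat t z) (Ioi 0) ∧
      ∫ t in Ioi (0 : ℝ), ‖z‖ / (2 * t) * heat t z = 1 / (2 * Real.pi * ‖z‖) := by
  have hr : 0 < ‖z‖ := norm_pos_iff.2 hz
  have hp := Real.pi_pos
  let c : ℝ := 1 / (2 * Real.pi * ‖z‖)
  let g₀ : ℝ → ℝ := fun t => c * Real.exp (-(‖z‖ ^ 2 / 4) * t⁻¹)
  -- An antiderivative in time. Its value at `0` has to be set to the limit `0`, because `0⁻¹ = 0`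
  -- gives `g₀ 0 = c`.
  let g : ℝ → ℝ := Function.update g₀ 0 0
  have hcont : ContinuousWithinAt g (Ici 0) 0 := by
    rw [continuousWithinAt_update_same, Ici_sdiff_left]
    have h1 : Tendsto (fun t : ℝ => -(‖z‖ ^ 2 / 4) * t⁻¹) (𝓝[>] 0) atBot :=
      tendsto_inv_nhdsGT_zero.const_mul_atTop_of_neg (by simpa using by positivity)
    have h2 := (Real.tendsto_exp_atBot.comp h1).const_mul c
    rwa [mul_zero] at h2
  have hderiv : ∀ t ∈ Ioi (0 : ℝ), HasDerivAt g (‖z‖ / (2 * t) * heat t z) t := by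
    intro t ht
    have ht' : (0 : ℝ) < t := ht
    have h1 := (((hasDerivAt_inv ht'.ne').const_mul (-(‖z‖ ^ 2 / 4))).exp).const_mul c
    have h2 : g =ᶠ[𝓝 t] g₀ := by
      filter_upwards [Ioi_mem_nhds ht'] with s hs
      exact Function.update_of_ne (ne_of_gt hs) _ _
    refine (h1.congr_of_eventuallyEq h2).congr_deriv ?_
    have h3 : -(‖z‖ ^ 2 / 4) * t⁻¹ = -‖z‖ ^ 2 / (4 * t) := by field_simp
    simp only [heat, c, h3]
    field_simp
  have hpos : ∀ t ∈ Ioi (0 : ℝ), 0 ≤ ‖z‖ / (2 * t) * heat t z := by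
    intro t ht
    have ht' : (0 : ℝ) < t := ht
    have := heat_nonneg ht'.le z
    positivity
  have hlim : Tendsto g atTop (𝓝 c) := by
    have h1 : Tendsto (fun t : ℝ => -(‖z‖ ^ 2 / 4) * t⁻¹) atTop (𝓝 0) := by
      have := (tendsto_inv_atTop_zero (𝕜 := ℝ)).const_mul (-(‖z‖ ^ 2 / 4))
      rwa [mul_zero] at this
    have h2 := ((Real.continuous_exp.tendsto 0).comp h1).const_mul c
    rw [Real.exp_zero, mul_one] at h2
    refine h2.congr' ?_
    filter_upwards [eventually_gt_atTop 0] with s hs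
    exact (Function.update_of_ne (ne_of_gt hs) 0 g₀).symm
  refine ⟨integrableOn_Ioi_deriv_of_nonneg hcont hderiv hpos hlim, ?_⟩
  rw [integral_Ioi_of_hasDerivAt_of_nonneg hcont hderiv hpos hlim]
  simp [g, c]

/-- A time independent bound for the gradient of the heat kernel away from the origin. -/
lemma heat_gradient_le {r : ℝ} (hr : 0 < r) {z : Plane} (hz : r ≤ ‖z‖) {t : ℝ} (ht : 0 < t) :
    ‖z‖ / (2 * t) * heat t z ≤ 8 / r ^ 3 := by
  have hp := Real.pi_gt_three
  have hz0 : 0 < ‖z‖ := hr.trans_le hz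
  set a := ‖z‖ ^ 2 / (4 * t) with ha
  have ha0 : 0 < a := by positivity
  -- The square of `(a/2) e^{-a/2} ≤ 1`.
  have h1 : a ^ 2 * Real.exp (-a) ≤ 4 := by
    have h2 := mul_exp_neg_le_one (a / 2)
    have h3 : 0 ≤ a / 2 * Real.exp (-(a / 2)) := by positivity
    have h4 : Real.exp (-a) = Real.exp (-(a / 2)) * Real.exp (-(a / 2)) := by
      rw [← Real.exp_add]; congr 1; ring
    rw [h4]
    nlinarith
  have h5 : ‖z‖ / (2 * t) * heat t z = 2 / (Real.pi * ‖z‖ ^ 3) * (a ^ 2 * Real.exp (-a)) := by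
    unfold heat
    rw [neg_div, ← ha]
    rw [show a ^ 2 = ‖z‖ ^ 4 / (16 * t ^ 2) by rw [ha]; field_simp; ring]
    field_simp
    norm_num
  rw [h5]
  calc _ ≤ 2 / (Real.pi * ‖z‖ ^ 3) * 4 := by gcongr
    _ ≤ 2 / (1 * r ^ 3) * 4 := by gcongr; linarith
    _ = _ := by ring

section gradient

variable {Γ : Curve} {α κ : ℝ} {τ : Plane → ℂ}

/-- The measure on `(0, ∞) × ℝ²` over which the heat kernel is integrated. -/
def timeSpace (Γ : Curve) : Measure (ℝ × Plane) := (volume.restrict (Ioi (0 : ℝ))).prod Γ.sigma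

instance : SFinite (timeSpace Γ) := by unfold timeSpace; infer_instance

lemma ae_timeSpace : ∀ᵐ p ∂timeSpace Γ, 0 < p.1 ∧ p.2 ∈ Γ.carrier := by
  have h1 : ∀ᵐ p ∂timeSpace Γ, p.1 ∈ Ioi (0 : ℝ) :=
    Measure.quasiMeasurePreserving_fst.ae (ae_restrict_mem measurableSet_Ioi)
  have h2 : ∀ᵐ p ∂timeSpace Γ, p.2 ∈ Γ.carrier :=
    Measure.quasiMeasurePreserving_snd.ae Γ.ae_mem_carrier
  filter_upwards [h1, h2] with p e1 e2 using ⟨e1, e2⟩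

/-- The integrand of the layer potential. -/
def layerIntegrand (κ : ℝ) (τ : Plane → ℂ) (x : Plane) (p : ℝ × Plane) : ℂ :=
  (Real.exp (-κ ^ 2 * p.1) : ℂ) * (τ p.2 * (heat p.1 (x - p.2) : ℂ))

lemma aestronglyMeasurable_layerIntegrand (hτ : MemLp τ 2 Γ.sigma) (x : Plane) :
    AEStronglyMeasurable (layerIntegrand κ τ x) (timeSpace Γ) := by
  refine AEStronglyMeasurable.mul (Continuous.aestronglyMeasurable (by fun_prop)) ?_
  exact hτ.aestronglyMeasurable.comp_snd.mul
    (Complex.measurable_ofReal.comp (measurable_heat_uncurry x)).aestronglyMeasurable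

lemma integrable_layerIntegrand (hκ : 0 < κ) (hτ : MemLp τ 2 Γ.sigma) (x : Plane) :
    Integrable (layerIntegrand κ τ x) (timeSpace Γ) := by
  have hm := aestronglyMeasurable_layerIntegrand (κ := κ) hτ x
  unfold timeSpace at hm ⊢
  rw [integrable_prod_iff hm]
  constructor
  · filter_upwards [ae_restrict_mem measurableSet_Ioi] with t ht
    have ht' : (0 : ℝ) < t := ht
    have hc := (contDiff_heat t).continuous
    have h1 : Continuous fun z => (heat t (x - z) : ℂ) := by fun_prop
    exact (integrable_mul_of_memLp hτ (Γ.memLp_of_continuous h1)).const_mul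
      (Real.exp (-κ ^ 2 * t) : ℂ)
  · obtain ⟨C, -, h⟩ := Γ.exists_integral_norm_mul_heat_le hτ
    refine Integrable.mono' (integrableOn_bound hκ C) hm.norm.integral_prod_right' ?_
    filter_upwards [ae_restrict_mem measurableSet_Ioi] with t ht
    have ht' : (0 : ℝ) < t := ht
    rw [Real.norm_eq_abs, abs_of_nonneg (integral_nonneg fun x => norm_nonneg _)]
    have : ∀ z, ‖layerIntegrand κ τ x (t, z)‖ =
        Real.exp (-κ ^ 2 * t) * (‖τ z‖ * heat t (x - z)) := by
      intro z
      simp only [layerIntegrand, norm_mul, Complex.norm_real, Real.norm_eq_abs,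
        abs_of_nonneg (heat_nonneg ht'.le _), abs_of_pos (Real.exp_pos _)]
    simp only [this]
    rw [integral_const_mul]
    calc _ ≤ Real.exp (-κ ^ 2 * t) * (C * t ^ (-3 / 4 : ℝ)) := by
          gcongr; exact h x t ht'
      _ = _ := by ring

lemma layerPotential_eq (hκ : 0 < κ) (hτ : MemLp τ 2 Γ.sigma) (x : Plane) :
    layerPotential Γ α κ τ x = α * ∫ p, layerIntegrand κ τ x p ∂timeSpace Γ := by
  have h := integrable_layerIntegrand hκ hτ x
  unfold timeSpace at h ⊢
  rw [integral_prod _ h]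
  unfold layerPotential heatConv layerIntegrand
  simp only [integral_const_mul]

/-- The coefficient in the derivative of the integrand of the layer potential. -/
def layerCoeff (κ : ℝ) (τ : Plane → ℂ) (x : Plane) (p : ℝ × Plane) : ℂ :=
  -((Real.exp (-κ ^ 2 * p.1) : ℂ) * (τ p.2 * ((heat p.1 (x - p.2) / (2 * p.1) : ℝ) : ℂ)))

/-- The derivative of the integrand of the layer potential. -/
def layerDeriv (κ : ℝ) (τ : Plane → ℂ) (x : Plane) (p : ℝ × Plane) : Plane →L[ℝ] ℂ :=
  layerCoeff κ τ x p • Complex.ofRealCLM.comp (innerSL ℝ (x - p.2))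

lemma layerDeriv_single (x : Plane) (p : ℝ × Plane) (i : Fin 2) :
    layerDeriv κ τ x p (EuclideanSpace.single i 1) =
      layerCoeff κ τ x p * (((x - p.2) i : ℝ) : ℂ) := by
  unfold layerDeriv
  rw [smul_apply, ContinuousLinearMap.comp_apply, innerSL_single, smul_eq_mul]
  rfl

lemma norm_layerDeriv_le (x : Plane) (p : ℝ × Plane) :
    ‖layerDeriv κ τ x p‖ ≤ ‖layerCoeff κ τ x p‖ * ‖x - p.2‖ := by
  unfold layerDeriv
  rw [norm_smul]
  refine mul_le_mul_of_nonneg_left ?_ (norm_nonneg _)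
  refine (ContinuousLinearMap.opNorm_comp_le _ _).trans ?_
  rw [innerSL_apply_norm, Complex.ofRealCLM_norm, one_mul]

lemma norm_layerCoeff_mul {x : Plane} {p : ℝ × Plane} (hp : 0 < p.1) :
    ‖layerCoeff κ τ x p‖ * ‖x - p.2‖ = Real.exp (-κ ^ 2 * p.1) *
      (‖τ p.2‖ * (‖x - p.2‖ / (2 * p.1) * heat p.1 (x - p.2))) := by
  have := heat_nonneg hp.le (x - p.2)
  simp only [layerCoeff, norm_neg, norm_mul, Complex.norm_real, Real.norm_eq_abs,
    abs_of_pos (Real.exp_pos _)]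
  rw [abs_of_nonneg (by positivity)]
  ring

lemma aestronglyMeasurable_layerCoeff (hτ : MemLp τ 2 Γ.sigma) (x : Plane) :
    AEStronglyMeasurable (layerCoeff κ τ x) (timeSpace Γ) := by
  refine (AEStronglyMeasurable.mul (Continuous.aestronglyMeasurable (by fun_prop)) ?_).neg
  refine hτ.aestronglyMeasurable.comp_snd.mul
    (Complex.measurable_ofReal.comp ?_).aestronglyMeasurable
  have := measurable_heat_uncurry x
  fun_prop

lemma hasFDerivAt_layerIntegrand (x : Plane) (p : ℝ × Plane) :
    HasFDerivAt (fun x => layerIntegrand κ τ x p) (layerDeriv κ τ x p) x := by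
  have h1 : HasFDerivAt (fun x => heat p.1 (x - p.2))
      ((-(heat p.1 (x - p.2) / (2 * p.1))) • innerSL ℝ (x - p.2)) x :=
    (HasFDerivAt.comp (g := heat p.1) (f := fun x => x - p.2) x (hasFDerivAt_heat p.1 (x - p.2))
      ((hasFDerivAt_id x).sub_const p.2)).congr_fderiv (by ext w; simp)
  have h2 : HasFDerivAt (fun x => (heat p.1 (x - p.2) : ℂ)) (Complex.ofRealCLM.comp
      ((-(heat p.1 (x - p.2) / (2 * p.1))) • innerSL ℝ (x - p.2))) x :=
    Complex.ofRealCLM.hasFDerivAt.comp x h1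
  refine ((h2.const_mul (τ p.2)).const_mul (Real.exp (-κ ^ 2 * p.1) : ℂ)).congr_fderiv ?_
  ext w
  simp [layerDeriv, layerCoeff]
  ring

/-- On a ball around `y` that stays at distance `r` from the curve, `heat_gradient_le` bounds the
derivative independently of time, and `e^{-κ²t}` supplies integrability. The first statement is kept
for Fubini in the gradient estimate. -/
lemma hasFDerivAt_layerPotential (hκ : 0 < κ) (hτ : MemLp τ 2 Γ.sigma) {y : Plane}
    (hy : y ∉ Γ.carrier) :
    Integrable (fun p => ‖layerCoeff κ τ y p‖ * ‖y - p.2‖) (timeSpace Γ) ∧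
    HasFDerivAt (layerPotential Γ α κ τ)
      ((α : ℂ) • ∫ p, layerDeriv κ τ y p ∂timeSpace Γ) y := by
  obtain ⟨ρ, hρ, hball⟩ := Metric.isOpen_iff.1 Γ.isCompact_carrier.isClosed.isOpen_compl y hy
  let r := ρ / 2
  have hr : 0 < r := half_pos hρ
  have hdist : ∀ x ∈ Metric.ball y r, ∀ z ∈ Γ.carrier, r ≤ ‖x - z‖ := by
    intro x hx z hz
    by_contra hlt
    rw [not_le] at hlt
    refine hball (a := z) ?_ hz
    rw [Metric.mem_ball, dist_comm, dist_eq_norm] at hx ⊢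
    have := norm_sub_le_norm_sub_add_norm_sub y x z
    simp only [r] at *
    linarith
  have hτi : Integrable (fun z => ‖τ z‖) Γ.sigma := (hτ.integrable one_le_two).norm
  have hbi : Integrable (fun p : ℝ × Plane => Real.exp (-κ ^ 2 * p.1) * (‖τ p.2‖ * (8 / r ^ 3)))
      (timeSpace Γ) := by
    have h1 : Integrable (fun t => Real.exp (-κ ^ 2 * t)) (volume.restrict (Ioi (0 : ℝ))) :=
      exp_neg_integrableOn_Ioi 0 (by positivity)
    exact h1.mul_prod (hτi.mul_const (8 / r ^ 3))
  have hbound : ∀ᵐ p ∂timeSpace Γ, ∀ x ∈ Metric.ball y r,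
      ‖layerCoeff κ τ x p‖ * ‖x - p.2‖ ≤ Real.exp (-κ ^ 2 * p.1) * (‖τ p.2‖ * (8 / r ^ 3)) := by
    filter_upwards [ae_timeSpace] with p hp x hx
    rw [norm_layerCoeff_mul hp.1]
    have := heat_gradient_le hr (hdist x hx _ hp.2) hp.1
    gcongr
  have hcm : AEStronglyMeasurable (fun p : ℝ × Plane => y - p.2) (timeSpace Γ) :=
    Continuous.aestronglyMeasurable (by fun_prop)
  constructor
  · refine Integrable.mono' hbi ((aestronglyMeasurable_layerCoeff hτ y).norm.mul hcm.norm) ?_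
    filter_upwards [hbound] with p hp
    rw [Real.norm_eq_abs, abs_of_nonneg (by positivity)]
    exact hp y (Metric.mem_ball_self hr)
  · have key := hasFDerivAt_integral_of_dominated_of_fderiv_le (𝕜 := ℝ) (μ := timeSpace Γ)
      (F := layerIntegrand κ τ) (F' := layerDeriv κ τ) (Metric.ball_mem_nhds y hr)
      (Eventually.of_forall fun x => aestronglyMeasurable_layerIntegrand hτ x)
      (integrable_layerIntegrand hκ hτ y) ?_ ?_ hbi
      (ae_of_all _ fun p x _ => hasFDerivAt_layerIntegrand x p)
    · have := key.const_mul (α : ℂ)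
      rwa [← funext (layerPotential_eq hκ hτ)] at this
    · refine (aestronglyMeasurable_layerCoeff hτ y).smul (Continuous.aestronglyMeasurable ?_)
      exact continuous_const.clm_comp ((innerSL ℝ).continuous.comp (by fun_prop))
    · filter_upwards [hbound] with p hp x hx
      exact (norm_layerDeriv_le x p).trans (hp x hx)

/-- Fubini with the time integral inside: after `e^{-κ²t} ≤ 1`, the time integral of the gradient of
the kernel is exactly `1/(2π |y - z|)`. Estimating the vector as a whole, not its components, keeps
this constant. -/
lemma norm_grad_layerPotential_le (hα : 0 < α) (hκ : 0 < κ) (hτ : MemLp τ 2 Γ.sigma) {N : ℝ}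
    (hN : ∀ᵐ z ∂Γ.sigma, ‖τ z‖ ≤ N) {y : Plane} (hy : y ∉ Γ.carrier) :
    ‖grad (layerPotential Γ α κ τ) y‖ ≤
      α * (N / (2 * Real.pi) * ∫ z, ‖y - z‖⁻¹ ∂Γ.sigma) := by
  obtain ⟨hint, hd⟩ := hasFDerivAt_layerPotential (α := α) hκ hτ hy
  have hcm : ∀ i, AEStronglyMeasurable (fun p : ℝ × Plane => (((y - p.2) i : ℝ) : ℂ))
      (timeSpace Γ) := fun i => Continuous.aestronglyMeasurable (by fun_prop)
  let V : ℝ × Plane → EuclideanSpace ℂ (Fin 2) := fun p =>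
    WithLp.toLp 2 fun i => layerCoeff κ τ y p * (((y - p.2) i : ℝ) : ℂ)
  have hVi : ∀ i, Integrable (fun p => V p i) (timeSpace Γ) := by
    intro i
    refine Integrable.mono' hint ((aestronglyMeasurable_layerCoeff hτ y).mul (hcm i))
      (ae_of_all _ fun p => ?_)
    simp only [V, norm_mul, Complex.norm_real, Real.norm_eq_abs]
    exact mul_le_mul_of_nonneg_left (abs_coord_le_norm _ i) (norm_nonneg _)
  have hVn : ∀ p, ‖V p‖ = ‖layerCoeff κ τ y p‖ * ‖y - p.2‖ := by
    intro p
    rw [EuclideanSpace.norm_eq, EuclideanSpace.norm_eq (y - p.2),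
      ← Real.sqrt_sq (norm_nonneg (layerCoeff κ τ y p)), ← Real.sqrt_mul (sq_nonneg _)]
    congr 1
    simp only [V, norm_mul, mul_pow, Finset.mul_sum, Complex.norm_real]
  have hcd : Integrable (layerDeriv κ τ y) (timeSpace Γ) := by
    refine Integrable.mono' hint ?_ (ae_of_all _ fun p => norm_layerDeriv_le y p)
    refine (aestronglyMeasurable_layerCoeff hτ y).smul (Continuous.aestronglyMeasurable ?_)
    exact continuous_const.clm_comp ((innerSL ℝ).continuous.comp (by fun_prop))
  have hgrad : grad (layerPotential Γ α κ τ) y = (α : ℂ) • ∫ p, V p ∂timeSpace Γ := by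
    ext i
    rw [grad_apply, hd.fderiv, PiLp.smul_apply, eval_integral_piLp hVi, smul_apply,
      ContinuousLinearMap.integral_apply hcd]
    simp only [layerDeriv_single, V]
  rw [hgrad, norm_smul, Complex.norm_real, Real.norm_eq_abs, abs_of_pos hα]
  refine mul_le_mul_of_nonneg_left ?_ hα.le
  calc _ ≤ ∫ p, ‖layerCoeff κ τ y p‖ * ‖y - p.2‖ ∂timeSpace Γ := by
        refine (norm_integral_le_integral_norm _).trans (le_of_eq ?_)
        simp only [hVn]
    _ = ∫ z, (∫ t in Ioi (0 : ℝ), ‖layerCoeff κ τ y (t, z)‖ * ‖y - z‖) ∂Γ.sigma := by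
        unfold timeSpace at hint ⊢
        exact integral_prod_symm _ hint
    _ ≤ ∫ z, N / (2 * Real.pi) * ‖y - z‖⁻¹ ∂Γ.sigma := by
        refine integral_mono_of_nonneg (ae_of_all _ fun z => integral_nonneg fun t =>
          mul_nonneg (norm_nonneg _) (norm_nonneg _)) ?_ ?_
        · refine Integrable.const_mul ?_ _
          obtain ⟨ρ, hρ, hball⟩ :=
            Metric.isOpen_iff.1 Γ.isCompact_carrier.isClosed.isOpen_compl y hy
          refine Integrable.of_bound (Measurable.aestronglyMeasurable (by fun_prop)) ρ⁻¹ ?_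
          filter_upwards [Γ.ae_mem_carrier] with z hz
          rw [norm_inv, norm_norm]
          refine inv_anti₀ hρ ?_
          by_contra hlt
          refine hball (a := z) ?_ hz
          rwa [Metric.mem_ball, dist_comm, dist_eq_norm, ← not_le]
        · filter_upwards [hN, Γ.ae_mem_carrier] with z hz hzc
          have hyz : y - z ≠ 0 := fun h0 => hy (by rwa [sub_eq_zero.1 h0])
          obtain ⟨hi, he⟩ := integral_heat_gradient hyz
          have hN0 : 0 ≤ N := (norm_nonneg _).trans hz
          calc _ ≤ ∫ t in Ioi (0 : ℝ), N * (‖y - z‖ / (2 * t) * heat t (y - z)) := by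
                refine integral_mono_of_nonneg (ae_of_all _ fun t =>
                  mul_nonneg (norm_nonneg _) (norm_nonneg _)) (hi.const_mul N) ?_
                filter_upwards [ae_restrict_mem measurableSet_Ioi] with t ht
                have ht' : (0 : ℝ) < t := ht
                rw [norm_layerCoeff_mul (p := (t, z)) ht']
                have h1 : Real.exp (-κ ^ 2 * t) ≤ 1 := by
                  rw [Real.exp_le_one_iff, neg_mul]
                  have : 0 ≤ κ ^ 2 * t := by positivity
                  linarith
                have h2 := heat_nonneg ht'.le (y - z)
                calc _ ≤ 1 * (N * (‖y - z‖ / (2 * t) * heat t (y - z))) := by gcongr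
                  _ = _ := one_mul _
            _ = _ := by
                rw [integral_const_mul, he]
                field_simp
    _ = _ := integral_const_mul _ _

end gradient

/-! ### Distances from an admissible point to the curve -/

/-- The supremum is attained: for `s ≠ s'` the quotient of chord and arc is an upper bound of the
defining set, which contains `0`. -/
lemma chordConst_mul_le {L m : ℝ} {c : ℝ → Plane} {s s' : ℝ} (hs : s ∈ Icc 0 L)
    (hs' : s' ∈ Icc 0 L) (h : |s - s'| ≤ m) : chordConst L c m * |s - s'| ≤ ‖c s - c s'‖ := by
  rcases eq_or_ne s s' with rfl | hne
  · simp
  · have hpos : 0 < |s - s'| := abs_pos.2 (sub_ne_zero.2 hne)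
    rw [← le_div_iff₀ hpos]
    refine csSup_le ⟨0, fun s _ s' _ _ => by simp⟩ fun M hM => ?_
    rw [le_div_iff₀ hpos]
    exact hM s hs s' hs' h

namespace Curve

variable (Γ : Curve)

lemma norm_sub_le {s s' : ℝ} (hs : s ∈ Icc 0 Γ.L) (hs' : s' ∈ Icc 0 Γ.L) :
    ‖Γ.γ s - Γ.γ s'‖ ≤ |s - s'| := by
  have := (convex_Icc 0 Γ.L).norm_image_sub_le_of_norm_derivWithin_le (f := Γ.γ) (C := 1)
    (Γ.contDiffOn.differentiableOn (by norm_num)) (fun x hx => (Γ.unit_speed x hx).le) hs' hs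
  simpa using this

lemma chordConst_le_one {m : ℝ} (hm : Γ.L / 2 ≤ m) : chordConst Γ.L Γ.γ m ≤ 1 := by
  have hL := Γ.L_pos
  have h0 : (0 : ℝ) ∈ Icc 0 Γ.L := ⟨le_rfl, hL.le⟩
  have h2 : Γ.L / 2 ∈ Icc 0 Γ.L := ⟨by linarith, by linarith⟩
  have h3 : |0 - Γ.L / 2| = Γ.L / 2 := by rw [zero_sub, abs_neg, abs_of_pos (half_pos hL)]
  have h1 := (chordConst_mul_le (c := Γ.γ) (m := m) h0 h2 (by rwa [h3])).trans (Γ.norm_sub_le h0 h2)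
  rw [h3] at h1
  nlinarith

lemma M_le_one : Γ.M ≤ 1 := by
  unfold M
  split_ifs
  · exact (min_le_left _ _).trans (Γ.chordConst_le_one le_rfl)
  · exact Γ.chordConst_le_one (by linarith [Γ.L_pos])

/-- Chord-arc and Taylor estimates in terms of an arc length distance `h`, which is taken
modulo `L` for closed curves. -/
lemma exists_arc {s s₀ : ℝ} (hs : s ∈ Icc 0 Γ.L) (hs₀ : s₀ ∈ Icc 0 Γ.L) :
    ∃ j ∈ ({s₀, s₀ + Γ.L, s₀ - Γ.L} : Finset ℝ), Γ.M * |s - j| ≤ ‖Γ.γ s - Γ.γ s₀‖ ∧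
      ‖Γ.γ s - Γ.γ s₀ - (s - j) • Γ.tangent s₀‖ ≤ Γ.K * |s - j| ^ 2 := by
  have hL := Γ.L_pos
  have h0 : (0 : ℝ) ∈ Icc 0 Γ.L := ⟨le_rfl, hL.le⟩
  have h1 : Γ.L ∈ Icc 0 Γ.L := ⟨hL.le, le_rfl⟩
  have hK := Γ.K_nonneg
  by_cases hcl : Γ.γ 0 = Γ.γ Γ.L
  · have hM : Γ.M = min (chordConst Γ.L Γ.γ (Γ.L / 2)) (chordConst Γ.L Γ.shifted (Γ.L / 2)) := by
      unfold M; rw [if_pos hcl]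
    have hT : Γ.tangent 0 = Γ.tangent Γ.L := Γ.deriv_closed hcl
    by_cases hd : |s - s₀| ≤ Γ.L / 2
    · refine ⟨s₀, by simp, ?_, Γ.norm_sub_sub_smul_tangent_le hs hs₀⟩
      refine le_trans ?_ (chordConst_mul_le hs hs₀ hd)
      rw [hM]
      exact mul_le_mul_of_nonneg_right (min_le_left _ _) (abs_nonneg _)
    · rw [not_le, lt_abs] at hd
      have hsh1 : ∀ r ∈ Icc 0 Γ.L, Γ.L / 2 < r → Γ.shifted (r - Γ.L / 2) = Γ.γ r := by
        intro r hr hr2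
        unfold shifted
        split_ifs with hlt
        · rw [sub_add_cancel]
        -- The glued parameterization takes the value `γ 0` at `L/2`, which is `γ L` as the curve is
        -- closed.
        · have : r = Γ.L := le_antisymm hr.2 (by linarith)
          rw [this, ← hcl]
          congr 1; ring
      have hsh2 : ∀ r ∈ Icc 0 Γ.L, r < Γ.L / 2 → Γ.shifted (r + Γ.L / 2) = Γ.γ r := by
        intro r hr hr2
        unfold shifted
        rw [if_neg (by linarith [hr.1]), add_sub_cancel_right]
      rcases hd with hd | hd
      · refine ⟨s₀ + Γ.L, by simp, ?_, ?_⟩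
        · have e1 : |s - Γ.L / 2 - (s₀ + Γ.L / 2)| = |s - (s₀ + Γ.L)| := by congr 1; ring
          have e2 := chordConst_mul_le (c := Γ.shifted) (m := Γ.L / 2) (L := Γ.L)
            (s := s - Γ.L / 2) (s' := s₀ + Γ.L / 2)
            ⟨by linarith [hs₀.1], by linarith [hs.2]⟩ ⟨by linarith [hs₀.1], by linarith [hs.2]⟩
            (by rw [abs_le]; constructor <;> linarith [hs.2, hs₀.1])
          rw [hsh1 s hs (by linarith [hs₀.1]), hsh2 s₀ hs₀ (by linarith [hs.2]), e1] at e2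
          refine le_trans ?_ e2
          rw [hM]
          exact mul_le_mul_of_nonneg_right (min_le_right _ _) (abs_nonneg _)
        · have t1 := Γ.norm_sub_sub_smul_tangent_le hs h1
          have t2 := Γ.norm_sub_sub_smul_tangent_le h0 hs₀
          have t3 := Γ.norm_tangent_sub_le h0 hs₀
          have a1 : |s - Γ.L| = Γ.L - s := by rw [abs_of_nonpos (by linarith [hs.2])]; ring
          have a2 : |0 - s₀| = s₀ := by rw [zero_sub, abs_neg, abs_of_nonneg hs₀.1]
          have a3 : |s - (s₀ + Γ.L)| = Γ.L - s + s₀ := by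
            rw [abs_of_nonpos (by linarith [hs.2, hs₀.1])]; ring
          rw [a1] at t1
          rw [a2] at t2 t3
          have t4 : ‖(s - Γ.L) • (Γ.tangent 0 - Γ.tangent s₀)‖ ≤ (Γ.L - s) * (Γ.K * s₀) := by
            rw [norm_smul, Real.norm_eq_abs, a1]
            exact mul_le_mul_of_nonneg_left t3 (by linarith [hs.2])
          -- Taylor expansion across the closing point: from `s` to `L`, from `0` to `s₀`, and the
          -- turning of the tangent between. With `p = L - s` the errors add up to `K (p² + s₀² + p
          -- s₀) ≤ K (p + s₀)²`.
          have e : Γ.γ s - Γ.γ s₀ - (s - (s₀ + Γ.L)) • Γ.tangent s₀ =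
              (Γ.γ s - Γ.γ Γ.L - (s - Γ.L) • Γ.tangent Γ.L) +
              (Γ.γ 0 - Γ.γ s₀ - (0 - s₀) • Γ.tangent s₀) +
              (s - Γ.L) • (Γ.tangent 0 - Γ.tangent s₀) := by
            rw [hcl, ← hT]; module
          rw [e, a3]
          refine (norm_add₃_le).trans ((add_le_add (add_le_add t1 t2) t4).trans ?_)
          have p1 : 0 ≤ Γ.K * ((Γ.L - s) * s₀) :=
            mul_nonneg hK (mul_nonneg (by linarith [hs.2]) hs₀.1)
          nlinarith
      · refine ⟨s₀ - Γ.L, by simp, ?_, ?_⟩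
        · have e1 : |s + Γ.L / 2 - (s₀ - Γ.L / 2)| = |s - (s₀ - Γ.L)| := by congr 1; ring
          have e2 := chordConst_mul_le (c := Γ.shifted) (m := Γ.L / 2) (L := Γ.L)
            (s := s + Γ.L / 2) (s' := s₀ - Γ.L / 2)
            ⟨by linarith [hs.1], by linarith [hs₀.2]⟩ ⟨by linarith [hs.1], by linarith [hs₀.2]⟩
            (by rw [abs_le]; constructor <;> linarith [hs.1, hs₀.2])
          rw [hsh2 s hs (by linarith [hs₀.2]), hsh1 s₀ hs₀ (by linarith [hs.1]), e1] at e2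
          refine le_trans ?_ e2
          rw [hM]
          exact mul_le_mul_of_nonneg_right (min_le_right _ _) (abs_nonneg _)
        · have t1 := Γ.norm_sub_sub_smul_tangent_le hs h0
          have t2 := Γ.norm_sub_sub_smul_tangent_le h1 hs₀
          have t3 := Γ.norm_tangent_sub_le h1 hs₀
          have a1 : |s - 0| = s := by rw [sub_zero, abs_of_nonneg hs.1]
          have a2 : |Γ.L - s₀| = Γ.L - s₀ := abs_of_nonneg (by linarith [hs₀.2])
          have a3 : |s - (s₀ - Γ.L)| = s + (Γ.L - s₀) := by
            rw [abs_of_nonneg (by linarith [hs.1, hs₀.2])]; ring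
          rw [a1] at t1
          rw [a2] at t2 t3
          have t4 : ‖s • (Γ.tangent Γ.L - Γ.tangent s₀)‖ ≤ s * (Γ.K * (Γ.L - s₀)) := by
            rw [norm_smul, Real.norm_eq_abs, abs_of_nonneg hs.1]
            exact mul_le_mul_of_nonneg_left t3 hs.1
          have e : Γ.γ s - Γ.γ s₀ - (s - (s₀ - Γ.L)) • Γ.tangent s₀ =
              (Γ.γ s - Γ.γ 0 - (s - 0) • Γ.tangent 0) +
              (Γ.γ Γ.L - Γ.γ s₀ - (Γ.L - s₀) • Γ.tangent s₀) +
              s • (Γ.tangent Γ.L - Γ.tangent s₀) := by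
            rw [hcl, ← hT]; module
          rw [e, a3]
          refine (norm_add₃_le).trans ((add_le_add (add_le_add t1 t2) t4).trans ?_)
          have p1 : 0 ≤ Γ.K * (s * (Γ.L - s₀)) :=
            mul_nonneg hK (mul_nonneg hs.1 (by linarith [hs₀.2]))
          nlinarith
  · refine ⟨s₀, by simp, ?_, Γ.norm_sub_sub_smul_tangent_le hs hs₀⟩
    have hM : Γ.M = chordConst Γ.L Γ.γ Γ.L := by unfold M; rw [if_neg hcl]
    rw [hM]
    refine chordConst_mul_le hs hs₀ ?_
    rw [abs_le]; constructor <;> linarith [hs.1, hs.2, hs₀.1, hs₀.2]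

lemma delta0_nonneg {c : ℝ} (hc : |c| ≤ 1) : 0 ≤ Γ.delta0 c := by
  have hL := Γ.L_pos
  have hK := Γ.K_nonneg
  unfold delta0
  split_ifs
  · linarith
  · refine le_min (by linarith) (mul_nonneg (div_nonneg ?_ (by linarith)) (by linarith))
    refine le_csSup_of_le ⟨1, fun M hM => ?_⟩ (b := 0) (fun s _ s' _ _ => by simp) le_rfl
    have h0 : (0 : ℝ) ∈ Icc 0 Γ.L := ⟨le_rfl, hL.le⟩
    have h2 : Γ.L / 2 ∈ Icc 0 Γ.L := ⟨by linarith, by linarith⟩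
    have h3 : |0 - Γ.L / 2| = Γ.L / 2 := by rw [zero_sub, abs_neg, abs_of_pos (by linarith)]
    have h1 := (hM 0 h0 (Γ.L / 2) h2 h3.le).trans (Γ.norm_sub_le h0 h2)
    rw [h3] at h1
    nlinarith

/-- This is what `δ₀` is made for: on arcs of length `δ₀` the curvature error is at most a quarter
of the transversality `1 - |cos θ|` times the length. The chord constant in `δ₀` is at most `1`. -/
lemma K_mul_delta0_le {c : ℝ} (hc : |c| ≤ 1) : Γ.K * Γ.delta0 c ≤ (1 - |c|) / 4 := by
  have hK := Γ.K_nonneg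
  unfold delta0
  split_ifs with h
  · rw [h]; linarith
  · have hKpos : 0 < Γ.K := lt_of_le_of_ne hK (Ne.symm h)
    refine (mul_le_mul_of_nonneg_left (min_le_right _ _) hK).trans ?_
    have h1 := Γ.chordConst_le_one le_rfl
    have h2 : Γ.K * (chordConst Γ.L Γ.γ (Γ.L / 2) / (2 * Γ.K) * ((1 - |c|) / 2)) =
        chordConst Γ.L Γ.γ (Γ.L / 2) * ((1 - |c|) / 4) := by
      field_simp; ring
    rw [h2]
    nlinarith

end Curve

/-- Transversality: the square of the right side is at least `q (d² + h²) + (1 - q) (d - |h|)²`,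
hence at least `q (d + |h|)² / 2`. The factor `7/10` works as `0.49 q² ≤ q / 2`. -/
lemma norm_smul_sub_smul_ge {e T : Plane} (he : ‖e‖ = 1) (hT : ‖T‖ = 1) {q : ℝ}
    (hq1 : q ≤ 1) (hq : q ≤ 1 - |inner ℝ e T|) (hq0 : 0 ≤ q) {d : ℝ} (hd : 0 ≤ d) (h : ℝ) :
    7 / 10 * q * (d + |h|) ≤ ‖d • e - h • T‖ := by
  refine abs_le_of_sq_le_sq' ?_ (norm_nonneg _) |>.2
  rw [norm_sub_sq_real, norm_smul, norm_smul, he, hT, inner_smul_left, inner_smul_right,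
    Real.norm_eq_abs, Real.norm_eq_abs, mul_one, mul_one, sq_abs, sq_abs]
  simp only [conj_trivial]
  have h1 : d * (h * inner ℝ e T) ≤ d * (|h| * (1 - q)) := by
    refine mul_le_mul_of_nonneg_left ?_ hd
    calc h * inner ℝ e T ≤ |h * inner ℝ e T| := le_abs_self _
      _ = |h| * |inner ℝ e T| := abs_mul _ _
      _ ≤ _ := mul_le_mul_of_nonneg_left (by linarith) (abs_nonneg _)
  have h2 : h ^ 2 = |h| ^ 2 := (sq_abs h).symm
  have h3 := abs_nonneg h
  have h4 : (7 / 10 * q * (d + |h|)) ^ 2 ≤ q * (d + |h|) ^ 2 / 2 := by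
    have : 0 ≤ q * (1 - q) * (d + |h|) ^ 2 := by
      have : 0 ≤ 1 - q := by linarith
      positivity
    have : 0 ≤ q * (d + |h|) ^ 2 := by positivity
    nlinarith
  have h5 : q * (d + |h|) ^ 2 / 2 ≤ q * (d ^ 2 + |h| ^ 2) := by
    have : 0 ≤ q * (d - |h|) ^ 2 := by positivity
    nlinarith
  have h6 : 0 ≤ (1 - q) * (d - |h|) ^ 2 := mul_nonneg (by linarith) (sq_nonneg _)
  rw [h2]
  nlinarith

lemma sqrt_three_div_two_le : Real.sqrt 3 / 2 ≤ 867 / 1000 := by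
  have : Real.sqrt 3 ≤ 1734 / 1000 := Real.sqrt_le_iff.2 ⟨by norm_num, by norm_num⟩
  linarith

namespace Curve

variable {Γ : Curve}

lemma IsAdmissible.rayDist_pos {P Q y e : Plane} {s : ℝ} (h : Γ.IsAdmissible P Q y e s) :
    0 < Γ.rayDist y e := by
  have h0 : 0 ≤ Γ.rayDist y e := Real.sInf_nonneg fun t ht => ht.1
  refine lt_of_le_of_ne h0 fun heq => h.not_mem ⟨s, h.param_mem, ?_⟩
  rw [h.first_hit, ← heq, zero_smul, sub_zero]

/-- Positivity of `M` need not be derived from compactness: `0 < d ≤ M δ₀ / 2` with `δ₀ ≥ 0` forces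
it. -/
lemma IsAdmissible.M_pos {P Q y e : Plane} {s : ℝ} (h : Γ.IsAdmissible P Q y e s)
    (hb : Γ.rayDist y e ≤ Γ.b1 (inner ℝ e (Γ.tangent s))) : 0 < Γ.M := by
  have hd := h.rayDist_pos
  have h1 := Γ.delta0_nonneg h.not_tangent.le
  unfold b1 at hb
  by_contra hM
  rw [not_lt] at hM
  nlinarith

/-- The distance from an admissible point to the points of the curve. -/
lemma IsAdmissible.exists_norm_sub_ge {P Q y e : Plane} {s₀ : ℝ}
    (h : Γ.IsAdmissible P Q y e s₀) (hθ : |inner ℝ e (Γ.tangent s₀)| ≤ Real.sqrt 3 / 2)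
    (hb : Γ.rayDist y e ≤ Γ.b1 (inner ℝ e (Γ.tangent s₀))) {s : ℝ} (hs : s ∈ Icc 0 Γ.L) :
    ∃ j ∈ ({s₀, s₀ + Γ.L, s₀ - Γ.L} : Finset ℝ),
      Γ.M / 20 * (Γ.rayDist y e + |s - j|) ≤ ‖y - Γ.γ s‖ := by
  obtain ⟨j, hj, hc, ht⟩ := Γ.exists_arc hs h.param_mem
  refine ⟨j, hj, ?_⟩
  have hM := h.M_pos hb
  have hM1 := Γ.M_le_one
  have hd := h.rayDist_pos
  have hK := Γ.K_nonneg
  have hδ := Γ.K_mul_delta0_le h.not_tangent.le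
  set d := Γ.rayDist y e
  set x := inner ℝ e (Γ.tangent s₀)
  set a := |s - j| with ha
  have ha0 : 0 ≤ a := abs_nonneg _
  have hq := hθ.trans sqrt_three_div_two_le
  have hx0 := abs_nonneg x
  have hy : y = Γ.γ s₀ + d • e := by rw [h.first_hit]; abel
  -- On the near arc the straight line estimate loses a quarter to curvature: `7/10 - 1/4 = 9/20`,
  -- and `(1 - |x|) · 9/20 ≥ 0.133 · 9/20 > 1/20 ≥ M/20`.
  rcases le_or_gt a (Γ.delta0 x) with hle | hgt
  · have h1 := norm_smul_sub_smul_ge h.norm_eq_one (Γ.norm_tangent h.param_mem)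
      (q := 1 - |x|) (by linarith) le_rfl (by linarith) hd.le (s - j)
    have h2 : Γ.K * a ^ 2 ≤ (1 - |x|) / 4 * a := by
      have : Γ.K * a ≤ (1 - |x|) / 4 := (mul_le_mul_of_nonneg_left hle hK).trans hδ
      nlinarith
    have h3 : ‖d • e - (s - j) • Γ.tangent s₀‖ ≤ ‖y - Γ.γ s‖ + Γ.K * a ^ 2 := by
      have e1 : d • e - (s - j) • Γ.tangent s₀ =
          (y - Γ.γ s) + (Γ.γ s - Γ.γ s₀ - (s - j) • Γ.tangent s₀) := by rw [hy]; abel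
      rw [e1]
      exact (norm_add_le _ _).trans (add_le_add_right ht _)
    have h4 : (1 - |x|) * 9 / 20 * (d + a) ≤ ‖y - Γ.γ s‖ := by
      have : 0 ≤ (1 - |x|) / 4 * d := mul_nonneg (by linarith) hd.le
      nlinarith
    refine le_trans (mul_le_mul_of_nonneg_right ?_ (by linarith)) h4
    linarith
  -- On the far arc `d ≤ M δ₀ / 2 < M a / 2`, so the chord bound leaves `‖y - γ s‖ ≥ M a - d ≥ M a /
  -- 2`, and `d` itself is at most `a / 2`.
  · have h1 : ‖Γ.γ s - Γ.γ s₀‖ ≤ ‖y - Γ.γ s‖ + d := by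
      have e1 : Γ.γ s - Γ.γ s₀ = d • e - (y - Γ.γ s) := by rw [hy]; abel
      rw [e1]
      refine (_root_.norm_sub_le _ _).trans ?_
      rw [norm_smul, h.norm_eq_one, mul_one, Real.norm_eq_abs, abs_of_pos hd, add_comm]
    have h2 : d ≤ Γ.M * a / 2 := by
      refine hb.trans ?_
      unfold b1
      nlinarith
    nlinarith

end Curve

/-! ### The logarithmic integral -/

lemma continuous_inv_add_abs {d : ℝ} (hd : 0 < d) (a : ℝ) :
    Continuous fun s : ℝ => (d + |s - a|)⁻¹ :=
  Continuous.inv₀ (by fun_prop) fun s => by positivity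

lemma integral_inv_add_abs_le {L d a : ℝ} (hL : 0 < L) (hd : 0 < d) (ha : -L ≤ a)
    (ha' : a ≤ 2 * L) :
    ∫ s in Icc 0 L, (d + |s - a|)⁻¹ ≤ 2 * (Real.log (d + 2 * L) - Real.log d) := by
  have hc := continuous_inv_add_abs hd a
  have hc0 : Continuous fun s : ℝ => (d + |s|)⁻¹ := by simpa using continuous_inv_add_abs hd 0
  have hhalf : ∫ s in (0 : ℝ)..2 * L, (d + |s|)⁻¹ = Real.log (d + 2 * L) - Real.log d := by
    have h1 : ∫ s in (0 : ℝ)..2 * L, (d + |s|)⁻¹ = ∫ s in (0 : ℝ)..2 * L, (d + s)⁻¹ := by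
      refine intervalIntegral.integral_congr fun s hs => ?_
      rw [uIcc_of_le (by linarith)] at hs
      simp only [abs_of_nonneg hs.1]
    rw [h1, intervalIntegral.integral_comp_add_left (fun s => s⁻¹) d, add_zero,
      integral_inv_of_pos hd (by linarith), Real.log_div (by linarith) hd.ne']
  -- All shifted base points `a` lie in `[-L, 2L]`, so the interval of radius `2L` about `a`
  -- contains `[0, L]`.
  calc _ ≤ ∫ s in Icc (a - 2 * L) (a + 2 * L), (d + |s - a|)⁻¹ := by
        refine setIntegral_mono_set (hc.integrableOn_Icc) (ae_of_all _ fun s => ?_)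
          (Icc_subset_Icc (by linarith) (by linarith)).eventuallyLE
        simp only [Pi.zero_apply]
        positivity
    _ = ∫ s in (a - 2 * L)..(a + 2 * L), (d + |s - a|)⁻¹ := by
        rw [integral_Icc_eq_integral_Ioc, intervalIntegral.integral_of_le (by linarith)]
    _ = ∫ s in (-(2 * L))..(2 * L), (d + |s|)⁻¹ := by
        rw [intervalIntegral.integral_comp_sub_right (fun s => (d + |s|)⁻¹) a]
        congr 1 <;> ring
    _ = (∫ s in (-(2 * L))..(-0), (d + |s|)⁻¹) + ∫ s in (0 : ℝ)..(2 * L), (d + |s|)⁻¹ := by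
        rw [neg_zero, intervalIntegral.integral_add_adjacent_intervals] <;>
          exact hc0.intervalIntegrable _ _
    _ = _ := by
        rw [← intervalIntegral.integral_comp_neg]
        simp only [abs_neg]
        rw [hhalf]; ring

lemma log_add_sub_log_le {L d : ℝ} (hd : 0 < d) (hd1 : d ≤ 1) (hL : 0 < L) :
    Real.log (d + 2 * L) - Real.log d ≤ 2 + Real.log (max 1 L) + |Real.log d| := by
  have h1 : 1 ≤ max 1 L := le_max_left _ _
  have h2 : L ≤ max 1 L := le_max_right _ _
  have h3 : Real.log (d + 2 * L) ≤ Real.log (3 * max 1 L) :=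
    Real.log_le_log (by linarith) (by linarith)
  rw [Real.log_mul (by norm_num) (by linarith)] at h3
  have h4 : Real.log 3 ≤ 2 := by
    have := Real.log_le_sub_one_of_pos (show (0 : ℝ) < 3 by norm_num)
    linarith
  linarith [neg_abs_le (Real.log d)]

namespace Curve

variable {Γ : Curve}

/-- Which of the three base points applies depends on `s`; summing over all of them avoids a case
distinction. The constant is `120 = 3 · 20 · 2`: base points, distance bound, two sides of each base
point. -/
lemma IsAdmissible.integral_inv_norm_le {P Q y e : Plane} {s₀ : ℝ}
    (h : Γ.IsAdmissible P Q y e s₀) (hθ : |inner ℝ e (Γ.tangent s₀)| ≤ Real.sqrt 3 / 2)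
    (hb : Γ.rayDist y e ≤ Γ.b1 (inner ℝ e (Γ.tangent s₀))) (hd1 : Γ.rayDist y e ≤ 1) :
    ∫ z, ‖y - z‖⁻¹ ∂Γ.sigma ≤
      120 / Γ.M * (2 + Real.log (max 1 Γ.L) + |Real.log (Γ.rayDist y e)|) := by
  have hM := h.M_pos hb
  have hd := h.rayDist_pos
  have hL := Γ.L_pos
  set d := Γ.rayDist y e with hd_def
  let J : Finset ℝ := {s₀, s₀ + Γ.L, s₀ - Γ.L}
  have hJ : J.card ≤ 3 := Finset.card_le_three
  have hint : ∀ j, IntegrableOn (fun s => (d + |s - j|)⁻¹) (Icc 0 Γ.L) :=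
    fun j => (continuous_inv_add_abs hd j).integrableOn_Icc
  have hB : 0 ≤ 2 + Real.log (max 1 Γ.L) + |Real.log d| := by
    have := Real.log_nonneg (le_max_left 1 Γ.L)
    positivity
  unfold sigma
  rw [integral_map Γ.aemeasurable (Measurable.aestronglyMeasurable (by fun_prop))]
  calc _ ≤ ∫ s in Icc 0 Γ.L, ∑ j ∈ J, 20 / Γ.M * (d + |s - j|)⁻¹ := by
        refine integral_mono_of_nonneg (ae_of_all _ fun s => inv_nonneg.2 (norm_nonneg _))
          (integrable_finsetSum _ fun j _ => (hint j).const_mul _) ?_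
        filter_upwards [ae_restrict_mem measurableSet_Icc] with s hs
        obtain ⟨j, hj, hle⟩ := h.exists_norm_sub_ge hθ hb hs
        refine le_trans ?_ (Finset.single_le_sum (f := fun j => 20 / Γ.M * (d + |s - j|)⁻¹)
          (fun j _ => by positivity) hj)
        have : 20 / Γ.M * (d + |s - j|)⁻¹ = (Γ.M / 20 * (d + |s - j|))⁻¹ := by
          rw [mul_inv, inv_div]
        simp only [this]
        exact inv_anti₀ (by positivity) hle
    _ = ∑ j ∈ J, 20 / Γ.M * ∫ s in Icc 0 Γ.L, (d + |s - j|)⁻¹ := by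
        rw [integral_finsetSum _ fun j _ => (hint j).const_mul _]
        simp only [integral_const_mul]
    _ ≤ ∑ j ∈ J, 20 / Γ.M * (2 * (2 + Real.log (max 1 Γ.L) + |Real.log d|)) := by
        refine Finset.sum_le_sum fun j hj => mul_le_mul_of_nonneg_left ?_ (by positivity)
        have hj' : -Γ.L ≤ j ∧ j ≤ 2 * Γ.L := by
          have h0 := h.param_mem
          simp only [J, Finset.mem_insert, Finset.mem_singleton] at hj
          rcases hj with rfl | rfl | rfl <;> constructor <;> linarith [h0.1, h0.2]
        exact (integral_inv_add_abs_le hL hd hj'.1 hj'.2).trans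
          (mul_le_mul_of_nonneg_left (log_add_sub_log_le hd hd1 hL) zero_le_two)
    _ = J.card * (20 / Γ.M * (2 * (2 + Real.log (max 1 Γ.L) + |Real.log d|))) := by
        rw [Finset.sum_const, nsmul_eq_mul]
    _ ≤ 3 * (20 / Γ.M * (2 * (2 + Real.log (max 1 Γ.L) + |Real.log d|))) := by
        refine mul_le_mul_of_nonneg_right (by exact_mod_cast hJ) (by positivity)
    _ = _ := by ring

end Curve

/-! ### The constants and the conclusion -/

lemma Curve.R_nonneg (Γ : Curve) : 0 ≤ Γ.R := Real.sInf_nonneg fun _ hr => hr.1.le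

lemma C5_nonneg : 0 ≤ C5 :=
  mul_nonneg zero_le_two (integral_nonneg fun x => by positivity)

lemma le_calS (Γ : Curve) (α κ c₃ c₄ : ℝ) :
    α * (c₃ + c₄ * Real.log (max 1 Γ.L)) ≤ calS Γ α κ c₃ c₄ := by
  have h1 := Γ.R_nonneg
  have h2 := C5_nonneg
  unfold calS
  have : 0 ≤ 2 * κ ^ 2 * (Γ.R + 1) + C5 * Real.sqrt (κ * Γ.R) * Real.exp (κ * Γ.R) := by positivity
  linarith

/-- A continuous function is bounded by its essential supremum. -/
lemma norm_le_eLpNorm_top {u ψ : Plane → ℂ} (hu : Continuous u) (h : u =ᵐ[volume] ψ)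
    (hψ : eLpNorm ψ ⊤ volume ≠ ⊤) (x : Plane) : ‖u x‖ ≤ (eLpNorm ψ ⊤ volume).toReal := by
  have h1 : ∀ᵐ x, ‖u x‖ ≤ (eLpNorm ψ ⊤ volume).toReal := by
    rw [← eLpNorm_congr_ae h] at hψ ⊢
    rw [eLpNorm_exponent_top] at hψ ⊢
    filter_upwards [ae_le_eLpNormEssSup (f := u) (μ := volume)] with x hx
    rw [← toReal_enorm]
    exact ENNReal.toReal_mono hψ hx
  have h2 : IsOpen {x | (eLpNorm ψ ⊤ volume).toReal < ‖u x‖} :=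
    isOpen_lt continuous_const hu.norm
  have h3 : volume {x | (eLpNorm ψ ⊤ volume).toReal < ‖u x‖} = 0 := by
    rw [ae_iff] at h1
    simpa only [not_le] using h1
  by_contra hx
  have := (h2.measure_eq_zero_iff volume).1 h3
  exact (this ▸ (show x ∈ {x | (eLpNorm ψ ⊤ volume).toReal < ‖u x‖} from not_le.1 hx) :
    x ∈ (∅ : Set Plane))

end LeakyCurve

end

theorem proposition6p5 :
    ∃ (c₃ : ℝ → ℝ → ℝ) (c₄ : ℝ → ℝ),
      ∀ (Γ : LeakyCurve.Curve) (α κ : ℝ), 0 < α → 0 < κ →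
      ∀ ψ : LeakyCurve.Plane → ℂ, LeakyCurve.IsEigenfunction Γ α (-κ ^ 2) ψ →
        MemLp ψ ∞ volume ∧
        ∃ u : LeakyCurve.Plane → ℂ,
          Continuous u ∧ u =ᵐ[volume] ψ ∧ DifferentiableOn ℝ u Γ.carrierᶜ ∧
          ∀ (P Q y e : LeakyCurve.Plane) (s : ℝ),
            Γ.IsAdmissible P Q y e s →
            |inner ℝ e (Γ.tangent s)| ≤ Real.sqrt 3 / 2 →
            Γ.rayDist y e ≤ dist P Q / 2 →
            dist P Q / 2 ≤ min 1 (Γ.b1 (inner ℝ e (Γ.tangent s))) →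
            ‖LeakyCurve.grad u y‖ ≤
              (LeakyCurve.calS Γ α κ (c₃ Γ.M Γ.K) (c₄ Γ.M) +
                α * c₄ Γ.M * |Real.log (Γ.rayDist y e)|) *
              (eLpNorm ψ ∞ volume).toReal := by
  -- `c₄` is the constant of `integral_inv_norm_le`, and `c₃` is twice that, from the summand `2` in
  -- `log_add_sub_log_le`.
  refine ⟨fun M _ => 240 / M, fun M => 120 / M, fun Γ α κ hα hκ ψ hψ => ?_⟩
  obtain ⟨G, τ, h⟩ := LeakyCurve.exists_weakSolution hψ
  have hτ := h.sobolev.trace.1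
  have hu := LeakyCurve.continuous_layerPotential (α := α) hκ hτ
  have hae := h.ae_eq_layerPotential hκ
  obtain ⟨B, hB⟩ := LeakyCurve.exists_norm_integral_heatConv_le (α := α) hκ hτ
  have hmem : MemLp ψ ⊤ volume := by
    refine memLp_top_of_bound h.sobolev.memLp.aestronglyMeasurable B ?_
    filter_upwards [hae] with x hx
    rw [hx]
    exact hB x _ measurableSet_Ioi Subset.rfl
  refine ⟨hmem, LeakyCurve.layerPotential Γ α κ τ, hu, hae.symm, fun y hy =>
    (LeakyCurve.hasFDerivAt_layerPotential hκ hτ hy).2.differentiableAt.differentiableWithinAt,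
    fun P Q y e s hadm hθ hd hb => ?_⟩
  have hN := LeakyCurve.norm_le_eLpNorm_top hu hae.symm hmem.2.ne
  set N := (eLpNorm ψ ⊤ volume).toReal with hN_def
  have hN0 : 0 ≤ N := ENNReal.toReal_nonneg
  have hb1 := hd.trans (hb.trans (min_le_right _ _))
  -- The continuous potential is bounded by `‖ψ‖_∞` at every point, hence also on the curve; this
  -- carries the essential bound over to the trace.
  have hτN : ∀ᵐ z ∂Γ.sigma, ‖τ z‖ ≤ N := by
    filter_upwards [h.norm_trace_le hα hκ] with z hz using hz.trans (hN z)
  refine (LeakyCurve.norm_grad_layerPotential_le hα hκ hτ hτN hadm.not_mem).trans ?_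
  have hI := hadm.integral_inv_norm_le hθ hb1 (hd.trans (hb.trans (min_le_left _ _)))
  have hM := hadm.M_pos hb1
  have hS := LeakyCurve.le_calS Γ α κ (240 / Γ.M) (120 / Γ.M)
  have hI0 : 0 ≤ ∫ z, ‖y - z‖⁻¹ ∂Γ.sigma := integral_nonneg fun z => inv_nonneg.2 (norm_nonneg _)
  have hNp : N / (2 * Real.pi) ≤ N := div_le_self hN0 (by linarith [Real.pi_gt_three])
  calc _ ≤ α * (N * (120 / Γ.M *
        (2 + Real.log (max 1 Γ.L) + |Real.log (Γ.rayDist y e)|))) := by gcongr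
    _ = (α * (240 / Γ.M + 120 / Γ.M * Real.log (max 1 Γ.L)) +
        α * (120 / Γ.M) * |Real.log (Γ.rayDist y e)|) * N := by ring
    _ ≤ _ := mul_le_mul_of_nonneg_right (by linarith) hN0
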